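/- **Model.** A network is a connected undirected graph on $k$ nodes in which every node $v$ of degree $d_v$ has ports $1,\dots,d_v$, each leading to a different neighbour (the port numbers at the two ends of an edge are unrelated), and every node has a unique identifier from $[1,k^4]$. All nodes start simultaneously and work in synchronous rounds. Initially a node knows only $k$, its identifier, its number of ports and a private string of independent fair coin flips. In each round it may send one message (a bit string of any length) through each of its ports, depending on what it knows initially and on the messages it has received so far; there are no failures. At any time every node marks some of its ports. An execution *constructs a spanning tree* if, from some round on, the set of edges marked by at least one endpoint no longer changes and is the edge set of a spanning tree of the graph. A randomized algorithm is a *spanning tree construction algorithm that succeeds with probability $1-o(1)$* if there is a sequence $\mathrm{err}(k)\to 0$ such that the algorithm constructs a spanning tree with probability at least $1-\mathrm{err}(k)$ on every network of $k$ nodes. The *conductance* of $G=(V,E)$ is $$\phi(G)=\min_{\emptyset\ne U\subsetneq V}\frac{|E(U,V\setminus U)|}{\min\{\mathrm{Vol}(U),\mathrm{Vol}(V\setminus U)\}},\qquad \mathrm{Vol}(U)=\sum_{v\in U}d_v .$$ **Statement.** There are absolute constants $a_1,a_2,b_1,b_2,c>0$ such that the following holds. Let $\mathcal A$ be a randomized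 spanning tree construction algorithm that succeeds with probability $1-o(1)$. Then there is $n_0$ such that for all $n\ge n_0$ and every real $\alpha$ with $\frac1{n^2}<\alpha<\frac1{12^2}$ there is a network (a connected graph $G$ with port numbers and identifiers) with between $a_1n$ and $a_2n$ nodes and with conductance $\phi=\phi(G)$ satisfying $b_1\alpha\le\phi\le b_2\alpha$, on which the expected total number of messages sent by $\mathcal A$ is at least $c\,n/\sqrt{\phi}$. -/

import Mathlib

open MeasureTheory Filter Topology
open scoped ENNReal

/-! ### Conductance -/

/-- The degree of a vertex of a graph on `Fin n`. -/
noncomputable def vertexDegree {n : ℕ} (G : SimpleGraph (Fin n)) (v : Fin n) : ℕ :=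
  (G.neighborSet v).ncard

/-- `Vol(U)`, the sum of the degrees of the vertices of `U`. -/
noncomputable def volumeOf {n : ℕ} (G : SimpleGraph (Fin n)) (U : Finset (Fin n)) : ℕ :=
  ∑ v ∈ U, vertexDegree G v

/-- The number of edges across the cut `(U, V \ U)`: every such edge is counted once, as the pair
(endpoint in `U`, endpoint outside `U`). -/
noncomputable def cutSize {n : ℕ} (G : SimpleGraph (Fin n)) (U : Finset (Fin n)) : ℕ :=
  {e : Fin n × Fin n | e.1 ∈ U ∧ e.2 ∉ U ∧ G.Adj e.1 e.2}.ncard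

/-- The cut-conductance `|E_K| / min {Vol(U), Vol(V \ U)}` of the cut `K = (U, V \ U)`. -/
noncomputable def cutConductance {n : ℕ} (G : SimpleGraph (Fin n)) (U : Finset (Fin n)) : ℝ :=
  (cutSize G U : ℝ) / (min (volumeOf G U) (volumeOf G Uᶜ) : ℕ)

/-- The conductance of `G`: the minimum of the cut-conductance over all cuts `(U, V \ U)` with both
sides non-empty (a finite family, non-empty as soon as `G` has at least two vertices). -/
noncomputable def conductance {n : ℕ} (G : SimpleGraph (Fin n)) : ℝ :=
  ⨅ U : {U : Finset (Fin n) // U.Nonempty ∧ Uᶜ.Nonempty}, cutConductance G U.1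

/-! ### Networks with port numbers and identifiers -/

/-- A network of `n` nodes: a graph, a numbering of the ports of every node (port `p` of `v` leads to
the neighbour `port v p`; the numberings at the two ends of an edge are unrelated), and
distinct identifiers from the range `[1, n ^ 4]`. -/
structure Network (n : ℕ) where
  graph : SimpleGraph (Fin n)
  port : (v : Fin n) → Fin (vertexDegree graph v) ≃ graph.neighborSet v
  ident : Fin n → ℕ
  ident_injective : Function.Injective ident
  ident_mem : ∀ v, ident v ∈ Set.Icc 1 (n ^ 4)

namespace Network

variable {n : ℕ}

/-- The number of ports of `v`. -/
noncomputable abbrev deg (N : Network n) (v : Fin n) : ℕ := vertexDegree N.graph v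

/-- The port of `u` that leads to its neighbour `v`. -/
def portTo (N : Network n) {u v : Fin n} (h : N.graph.Adj u v) : Fin (N.deg u) :=
  (N.port u).symm ⟨v, h⟩

theorem adj_port (N : Network n) (v : Fin n) (p : Fin (N.deg v)) :
    N.graph.Adj (N.port v p).1 v :=
  ((N.port v p).2 : N.graph.Adj v (N.port v p).1).symm

end Network

/-! ### Randomized synchronous message-passing algorithms -/

/-- Messages are finite bit strings, of any length. -/
abbrev Message : Type := List Bool

/-- What a node with `d` ports receives in one round: at most one message through each port. -/
abbrev Inbox (d : ℕ) : Type := Fin d → Option Message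

/-- A randomized algorithm of the synchronous model without any bound on the message length or on the
local computation. All that a node has at the start of a round is the number `n` of nodes, its
identifier, the number `d` of its ports, its private infinite random bit string, and the list
of the inboxes of all previous rounds (the most recent one first). From these, `send` determines for
every port the message that the node sends through it in this round (`none`: no message), and `mark`
says which of its incident edges the node currently declares to be in the spanning tree.
Both depend measurably on the random bit string. -/
structure DistAlgorithm where
  send : (n ident d : ℕ) → (ℕ → Bool) → List (Inbox d) → Fin d → Option Message
  mark : (n ident d : ℕ) → (ℕ → Bool) → List (Inbox d) → Fin d → Bool
  measurableSet_send : ∀ n ident d (h : List (Inbox d)) (p : Fin d) (m : Option Message),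
    MeasurableSet {r : ℕ → Bool | send n ident d r h p = m}
  measurableSet_mark : ∀ n ident d (h : List (Inbox d)) (p : Fin d) (b : Bool),
    MeasurableSet {r : ℕ → Bool | mark n ident d r h p = b}

/-- The law of an infinite sequence of independent fair coin flips. -/
noncomputable def coinFlips : Measure (ℕ → Bool) :=
  Measure.infinitePi fun _ => (PMF.uniformOfFintype Bool).toMeasure

/-- The law of the random bit strings of `n` nodes: they are independent. -/
noncomputable def nodeCoins (n : ℕ) : Measure (Fin n → ℕ → Bool) :=
  Measure.pi fun _ => coinFlips

namespace DistAlgorithm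

variable {n : ℕ}

/-- The inboxes of the rounds `0, …, t - 1` at node `v`, the most recent one first, in the execution
on `N` with random bit strings `r`. All nodes start in round `0`; what a node sends in a
round is received by its neighbour, through the port at the other end, by the end of this round. -/
noncomputable def history (A : DistAlgorithm) (N : Network n) (r : Fin n → ℕ → Bool) :
    ℕ → (v : Fin n) → List (Inbox (N.deg v))
  | 0, _ => []
  | t + 1, v =>
      (fun p : Fin (N.deg v) =>
        A.send n (N.ident (N.port v p).1) (N.deg (N.port v p).1) (r (N.port v p).1)
          (history A N r t (N.port v p).1) (N.portTo (N.adj_port v p)))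
      :: history A N r t v

/-- What `v` sends through its port `p` in round `t`. -/
noncomputable def sent (A : DistAlgorithm) (N : Network n) (r : Fin n → ℕ → Bool)
    (t : ℕ) (v : Fin n) (p : Fin (N.deg v)) : Option Message :=
  A.send n (N.ident v) (N.deg v) (r v) (A.history N r t v) p

/-- The total number of messages sent in the execution, over all rounds, nodes and ports. -/
noncomputable def messages (A : DistAlgorithm) (N : Network n) (r : Fin n → ℕ → Bool) : ℝ≥0∞ :=
  ∑' t : ℕ, ∑ v : Fin n, ∑ p : Fin (N.deg v), if (A.sent N r t v p).isSome then 1 else 0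

/-- The expected number of messages. -/
noncomputable def expectedMessages (A : DistAlgorithm) (N : Network n) : ℝ≥0∞ :=
  ∫⁻ r, A.messages N r ∂(nodeCoins n)

/-- After `t` rounds, `v` declares the edge of its port `p` to be in the tree. -/
noncomputable def marked (A : DistAlgorithm) (N : Network n) (r : Fin n → ℕ → Bool)
    (t : ℕ) (v : Fin n) (p : Fin (N.deg v)) : Prop :=
  A.mark n (N.ident v) (N.deg v) (r v) (A.history N r t v) p = true

/-- The subgraph that is declared after `t` rounds: the edges of the network marked by at least one
endpoint. (So it is allowed, but not required, that both ends mark an edge; for a rooted tree it is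
enough that every node other than the root marks the port to its parent.) -/
def output (A : DistAlgorithm) (N : Network n) (r : Fin n → ℕ → Bool) (t : ℕ) :
    SimpleGraph (Fin n) where
  Adj u v := ∃ h : N.graph.Adj u v,
    A.marked N r t u (N.portTo h) ∨ A.marked N r t v (N.portTo h.symm)
  symm := ⟨fun _ _ ⟨h, hm⟩ => ⟨h.symm, hm.symm⟩⟩
  loopless := ⟨fun _ ⟨h, _⟩ => h.ne rfl⟩

/-- The execution constructs a spanning tree: from some round on, the declared subgraph is one and
the same spanning tree of the network. -/
def Success (A : DistAlgorithm) (N : Network n) (r : Fin n → ℕ → Bool) : Prop :=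
  ∃ T : SimpleGraph (Fin n), T.IsTree ∧ ∀ᶠ t in atTop, A.output N r t = T

/-- `A` is a spanning tree construction algorithm that succeeds with probability `1 - o(1)`: for some
`err n → 0`, it succeeds with probability at least `1 - err n` on every connected network
of `n` nodes, whatever the port numbers and identifiers. -/
def ConstructsSpanningTrees (A : DistAlgorithm) : Prop :=
  ∃ err : ℕ → ℝ, Tendsto err atTop (𝓝 0) ∧
    ∀ (n : ℕ) (N : Network n), N.graph.Connected →
      1 - err n ≤ (nodeCoins n).real {r | A.Success N r}

end DistAlgorithm

/-! Take `M` outer blocks `K_{s,s}` and a hub `K_{Ms,Ms}` with `M` marked blocks; for every `i`, let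
one edge of the outer block and one edge of the hub block exchange their second ends. Degrees, ports
and identifiers stay the same, so the nodes cannot notice which two edges were crossed before a
message travels along one of them. But these two edges are all that ties the outer block to the
rest, so every spanning tree contains one of them.

Fix the coins and the crossings of all other blocks, and compare the `s^4` crossings of block `i`
with a single reference execution in which block `i` is uncrossed (`dartHistory_eq_of_silent`). If
the crossed edges are never used, the real execution is the reference one. Its marked edges within
either block are a forest plus at most one edge, so at most `2s+1` on each level, and a successful
crossing must hit them; few crossings do. If the crossed edges are used, at the first use either at
least `s^2/8` edges of one of the two blocks have been used, which costs that many messages, or the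
crossing hits one of the few edges used early. Hence at most half of the crossings are both
successful and cheap (`card_success_cheap_le`).

Averaging over crossings and coins, with success probability at least `3/4`, leaves weight `1/4` for
executions with `s^2/8` messages in block `i`. Summing over `i` gives `M s^2 / 32` expected messages
for some crossing (`exists_le_expectedMessages`).

The conductance is of order `1/s^2`: an outer block has volume `2s^2` and two outgoing edges, while
the hub expands so well that no cut is much worse (`card_volumeDarts_le`). With `s` of order `1/√α`
and `Ms` of order `n`, the message bound is of order `n s`, that is, `n/√φ`. -/

/-! ### Darts and port numberings -/

section Darts

variable {X : Type} [Fintype X] {k : ℕ}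

/-- The number of darts that start at `v`. -/
def portCount (src : X → Fin k) (v : Fin k) : ℕ := Fintype.card {x // src x = v}

/-- A numbering of the darts that start at `v`. -/
noncomputable def portEquiv (src : X → Fin k) (v : Fin k) :
    Fin (portCount src v) ≃ {x // src x = v} :=
  (Fintype.equivFin _).symm

/-- The port number of a dart at its source. -/
noncomputable def portIndex (src : X → Fin k) (x : X) : Fin (portCount src (src x)) :=
  (portEquiv src (src x)).symm ⟨x, rfl⟩

theorem src_portEquiv (src : X → Fin k) (v : Fin k) (p : Fin (portCount src v)) :
    src (portEquiv src v p).1 = v :=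
  (portEquiv src v p).2

/-- The histories of an execution on the darts, where the dart `x` is joined to the dart `opp x`. -/
noncomputable def dartHistory (A : DistAlgorithm) (src : X → Fin k) (opp : X → X) (ident : Fin k → ℕ)
    (r : Fin k → ℕ → Bool) : ℕ → (v : Fin k) → List (Inbox (portCount src v))
  | 0, _ => []
  | t + 1, v =>
      (fun p =>
        A.send k (ident (src (opp (portEquiv src v p).1)))
          (portCount src (src (opp (portEquiv src v p).1)))
          (r (src (opp (portEquiv src v p).1)))
          (dartHistory A src opp ident r t (src (opp (portEquiv src v p).1)))
          (portIndex src (opp (portEquiv src v p).1)))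
      :: dartHistory A src opp ident r t v

/-- The message sent along the dart `x` in round `t`. -/
noncomputable def dartSent (A : DistAlgorithm) (src : X → Fin k) (opp : X → X) (ident : Fin k → ℕ)
    (r : Fin k → ℕ → Bool) (t : ℕ) (x : X) : Option Message :=
  A.send k (ident (src x)) (portCount src (src x)) (r (src x))
    (dartHistory A src opp ident r t (src x)) (portIndex src x)

/-- The dart `x` is marked by its source after `t` rounds. -/
def dartMarked (A : DistAlgorithm) (src : X → Fin k) (opp : X → X) (ident : Fin k → ℕ)
    (r : Fin k → ℕ → Bool) (t : ℕ) (x : X) : Prop :=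
  A.mark k (ident (src x)) (portCount src (src x)) (r (src x))
    (dartHistory A src opp ident r t (src x)) (portIndex src x) = true

theorem dartHistory_succ (A : DistAlgorithm) (src : X → Fin k) (opp : X → X) (ident : Fin k → ℕ)
    (r : Fin k → ℕ → Bool) (t : ℕ) (v : Fin k) :
    dartHistory A src opp ident r (t + 1) v =
      (fun p => dartSent A src opp ident r t (opp (portEquiv src v p).1)) ::
        dartHistory A src opp ident r t v :=
  rfl

end Darts

/-! ### Dart systems and the networks they define -/

/-- A simple graph on `Fin k` given by its darts: `src x` is the source of the dart `x`, and `opp x`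
is the reversed dart. -/
structure DartSystem (X : Type) (k : ℕ) where
  src : X → Fin k
  opp : X → X
  opp_opp : ∀ x, opp (opp x) = x
  src_opp_ne : ∀ x, src (opp x) ≠ src x
  eq_of_src_eq : ∀ x y, src x = src y → src (opp x) = src (opp y) → x = y

namespace DartSystem

variable {X : Type} {k : ℕ}

/-- The graph of a dart system. -/
def toGraph (S : DartSystem X k) : SimpleGraph (Fin k) where
  Adj u v := ∃ x, S.src x = u ∧ S.src (S.opp x) = v
  symm := ⟨fun _ _ ⟨x, hu, hv⟩ => ⟨S.opp x, hv, by rw [S.opp_opp, hu]⟩⟩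
  loopless := ⟨fun _ ⟨x, hu, hv⟩ => S.src_opp_ne x (hv.trans hu.symm)⟩

theorem adj_opp (S : DartSystem X k) (x : X) : S.toGraph.Adj (S.src x) (S.src (S.opp x)) :=
  ⟨x, rfl, rfl⟩

/-- The darts at `v` correspond to the neighbours of `v`. -/
noncomputable def dartsEquivNeighbors (S : DartSystem X k) (v : Fin k) :
    {x // S.src x = v} ≃ S.toGraph.neighborSet v :=
  Equiv.ofBijective (fun x => ⟨S.src (S.opp x.1), x.1, x.2, rfl⟩) <| by
    constructor
    · rintro ⟨x, hx⟩ ⟨y, hy⟩ h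
      exact Subtype.ext (S.eq_of_src_eq x y (hx.trans hy.symm) (Subtype.ext_iff.1 h))
    · rintro ⟨w, x, hx, hw⟩
      exact ⟨⟨x, hx⟩, Subtype.ext hw⟩

variable [Fintype X]

theorem vertexDegree_toGraph (S : DartSystem X k) (v : Fin k) :
    vertexDegree S.toGraph v = portCount S.src v := by
  rw [vertexDegree, portCount, ← Nat.card_eq_fintype_card, ← Nat.card_coe_set_eq]
  exact (Nat.card_congr (S.dartsEquivNeighbors v)).symm

/-- The network of a dart system, with the ports numbered by `portEquiv`. -/
noncomputable def toNetwork (S : DartSystem X k) : Network k where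
  graph := S.toGraph
  port v := (finCongr (S.vertexDegree_toGraph v)).trans
    ((portEquiv S.src v).trans (S.dartsEquivNeighbors v))
  ident v := v + 1
  ident_injective u v h := Fin.ext (Nat.succ_injective h)
  ident_mem v := ⟨Nat.le_add_left 1 _, v.2.trans_le (Nat.le_self_pow (by norm_num) k)⟩

theorem deg_toNetwork (S : DartSystem X k) (v : Fin k) :
    S.toNetwork.deg v = portCount S.src v :=
  S.vertexDegree_toGraph v

theorem adj_toNetwork (S : DartSystem X k) {u w : Fin k} (x : X) (hu : S.src x = u)
    (hw : S.src (S.opp x) = w) : S.toNetwork.graph.Adj u w :=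
  ⟨x, hu, hw⟩

theorem portTo_toNetwork (S : DartSystem X k) (x : X) {w : Fin k}
    (hw : S.src (S.opp x) = w) (h : S.toNetwork.graph.Adj (S.src x) w) :
    S.toNetwork.portTo h = Fin.cast (S.deg_toNetwork (S.src x)).symm (portIndex S.src x) := by
  refine (Equiv.symm_apply_eq (S.toNetwork.port (S.src x))).2 (Subtype.ext ?_)
  subst hw
  have h1 : ((S.toNetwork.port (S.src x))
      (Fin.cast (S.deg_toNetwork (S.src x)).symm (portIndex S.src x))).1 =
      S.src (S.opp (portEquiv S.src (S.src x) (portIndex S.src x)).1) := rfl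
  rw [h1, portIndex, Equiv.apply_symm_apply]

/-- The identifiers of `toNetwork`. -/
def succIdent (v : Fin k) : ℕ := v + 1

theorem send_cast (A : DistAlgorithm) (n i : ℕ) (r : ℕ → Bool) {d d' : ℕ} (h : d = d')
    (l : List (Inbox d')) (p : Fin d') :
    A.send n i d r (l.map fun m q => m (Fin.cast h q)) (Fin.cast h.symm p) = A.send n i d' r l p := by
  subst h; simp

theorem mark_cast (A : DistAlgorithm) (n i : ℕ) (r : ℕ → Bool) {d d' : ℕ} (h : d = d')
    (l : List (Inbox d')) (p : Fin d') :
    A.mark n i d r (l.map fun m q => m (Fin.cast h q)) (Fin.cast h.symm p) = A.mark n i d' r l p := by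
  subst h; simp

theorem send_history_eq_dartSent (S : DartSystem X k) (A : DistAlgorithm) (r : Fin k → ℕ → Bool)
    (t : ℕ) (x : X) {w : Fin k} (hw : S.src (S.opp x) = w)
    (h : S.toNetwork.graph.Adj (S.src x) w)
    (hh : A.history S.toNetwork r t (S.src x) =
      (dartHistory A S.src S.opp succIdent r t (S.src x)).map
        fun m p => m (Fin.cast (S.deg_toNetwork (S.src x)) p)) :
    A.send k (S.toNetwork.ident (S.src x)) (S.toNetwork.deg (S.src x)) (r (S.src x))
      (A.history S.toNetwork r t (S.src x)) (S.toNetwork.portTo h) =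
    dartSent A S.src S.opp succIdent r t x := by
  rw [hh, S.portTo_toNetwork x hw]
  exact send_cast A _ _ _ (S.deg_toNetwork (S.src x)) _ _

/-- The degree in the network equals `portCount` only propositionally, hence the casts. In dart form
the type of a history depends on `src` alone, so executions with different `opp` can be compared by
plain equality. -/
theorem history_toNetwork (S : DartSystem X k) (A : DistAlgorithm) (r : Fin k → ℕ → Bool) (t : ℕ) :
    ∀ v, A.history S.toNetwork r t v =
      (dartHistory A S.src S.opp succIdent r t v).map
        fun m p => m (Fin.cast (S.deg_toNetwork v) p) := by
  induction t with
  | zero => intro v; rfl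
  | succ t ih =>
    intro v
    rw [dartHistory_succ, List.map_cons, ← ih v, DistAlgorithm.history]
    congr 1
    funext p
    exact S.send_history_eq_dartSent A r t
      (S.opp (portEquiv S.src v (Fin.cast (S.deg_toNetwork v) p)).1)
      (by rw [S.opp_opp]; exact src_portEquiv _ _ _) _ (ih _)

/-- Darts are pairs of a vertex and a port. -/
noncomputable def portsEquivDarts (S : DartSystem X k) :
    (Σ v : Fin k, Fin (S.toNetwork.deg v)) ≃ X :=
  (Equiv.sigmaCongrRight fun v => (finCongr (S.deg_toNetwork v)).trans
    (portEquiv S.src v)).trans (Equiv.sigmaFiberEquiv S.src)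

theorem sent_toNetwork (S : DartSystem X k) (A : DistAlgorithm) (r : Fin k → ℕ → Bool) (t : ℕ)
    (v : Fin k) (p : Fin (S.toNetwork.deg v)) :
    A.sent S.toNetwork r t v p =
      dartSent A S.src S.opp succIdent r t (S.portsEquivDarts ⟨v, p⟩) := by
  obtain ⟨q, rfl⟩ : ∃ q : Fin (portCount S.src v), p = Fin.cast (S.deg_toNetwork v).symm q :=
    ⟨Fin.cast (S.deg_toNetwork v) p, rfl⟩
  obtain ⟨⟨x, rfl⟩, rfl⟩ := (portEquiv S.src v).symm.surjective q
  have hx : S.portsEquivDarts ⟨S.src x, Fin.cast (S.deg_toNetwork (S.src x)).symm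
      ((portEquiv S.src (S.src x)).symm ⟨x, rfl⟩)⟩ =
      (portEquiv S.src (S.src x) ((portEquiv S.src (S.src x)).symm ⟨x, rfl⟩)).1 := rfl
  rw [hx, Equiv.apply_symm_apply,
    ← S.send_history_eq_dartSent A r t x rfl (S.adj_toNetwork x rfl rfl)
      (S.history_toNetwork A r t _), S.portTo_toNetwork x rfl]
  rfl

theorem messages_toNetwork (S : DartSystem X k) (A : DistAlgorithm) (r : Fin k → ℕ → Bool) :
    A.messages S.toNetwork r =
      ∑' t, ∑ x, if (dartSent A S.src S.opp succIdent r t x).isSome then 1 else 0 := by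
  unfold DistAlgorithm.messages
  congr 1
  funext t
  rw [← S.portsEquivDarts.sum_comp, Fintype.sum_sigma]
  simp_rw [sent_toNetwork]

theorem marked_toNetwork (S : DartSystem X k) (A : DistAlgorithm) (r : Fin k → ℕ → Bool) (t : ℕ)
    (x : X) {u w : Fin k} (hu : S.src x = u) (hw : S.src (S.opp x) = w)
    (h : S.toNetwork.graph.Adj u w) :
    A.marked S.toNetwork r t u (S.toNetwork.portTo h) ↔
      dartMarked A S.src S.opp succIdent r t x := by
  subst hu
  rw [DistAlgorithm.marked, history_toNetwork, S.portTo_toNetwork x hw, dartMarked]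
  exact iff_of_eq (congrArg (· = true) (mark_cast A _ _ _ (S.deg_toNetwork _) _ _))

theorem output_toNetwork_adj (S : DartSystem X k) (A : DistAlgorithm) (r : Fin k → ℕ → Bool)
    (t : ℕ) (u w : Fin k) :
    (A.output S.toNetwork r t).Adj u w ↔ ∃ x, S.src x = u ∧ S.src (S.opp x) = w ∧
      (dartMarked A S.src S.opp succIdent r t x ∨
        dartMarked A S.src S.opp succIdent r t (S.opp x)) := by
  have key : ∀ (x : X) (hu : S.src x = u) (hw : S.src (S.opp x) = w)
      (h : S.toNetwork.graph.Adj u w),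
      (A.marked S.toNetwork r t u (S.toNetwork.portTo h) ∨
        A.marked S.toNetwork r t w (S.toNetwork.portTo h.symm)) ↔
      (dartMarked A S.src S.opp succIdent r t x ∨
        dartMarked A S.src S.opp succIdent r t (S.opp x)) := fun x hu hw h =>
    or_congr (S.marked_toNetwork A r t x hu hw h)
      (S.marked_toNetwork A r t (S.opp x) hw (by rw [S.opp_opp, hu]) h.symm)
  constructor
  · rintro ⟨h, hm⟩
    obtain ⟨x, hu, hw⟩ := id h
    exact ⟨x, hu, hw, (key x hu hw h).1 hm⟩
  · rintro ⟨x, hu, hw, hm⟩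
    exact ⟨⟨x, hu, hw⟩, (key x hu hw ⟨x, hu, hw⟩).2 hm⟩

theorem volumeOf_toGraph (S : DartSystem X k) (U : Finset (Fin k)) :
    volumeOf S.toGraph U = (Finset.univ.filter fun x => S.src x ∈ U).card := by
  rw [volumeOf, Finset.card_eq_sum_card_fiberwise (f := S.src) (t := U) (by intro x; simp)]
  refine Finset.sum_congr rfl fun v hv => ?_
  rw [vertexDegree_toGraph, portCount, Fintype.card_subtype]
  congr 1
  ext x
  simp only [Finset.mem_filter, Finset.mem_univ, true_and]
  exact ⟨fun h => ⟨h ▸ hv, h⟩, fun h => h.2⟩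

theorem cutSize_toGraph (S : DartSystem X k) (U : Finset (Fin k)) :
    cutSize S.toGraph U =
      (Finset.univ.filter fun x => S.src x ∈ U ∧ S.src (S.opp x) ∉ U).card := by
  classical
  rw [cutSize, ← Set.ncard_coe_finset]
  symm
  refine Set.ncard_congr (fun x _ => (S.src x, S.src (S.opp x))) ?_ ?_ ?_
  · intro x hx
    simp only [Finset.coe_filter, Finset.mem_univ, true_and, Set.mem_ofPred_eq] at hx
    exact ⟨hx.1, hx.2, S.adj_opp x⟩
  · intro x y _ _ h
    exact S.eq_of_src_eq x y (Prod.ext_iff.1 h).1 (Prod.ext_iff.1 h).2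
  · rintro ⟨u, w⟩ ⟨hu, hw, x, rfl, rfl⟩
    exact ⟨x, by simpa using ⟨hu, hw⟩, rfl⟩

end DartSystem

/-! ### Executions that cannot be told apart -/

section Coupling

variable {X : Type} [Fintype X] {k : ℕ}

/-- The wiring `opp` influences a message only through the history of its sender. -/
theorem dartSent_congr {A : DistAlgorithm} {src : X → Fin k} {opp opp' : X → X} {ident : Fin k → ℕ}
    {r : Fin k → ℕ → Bool} {t : ℕ}
    (h : dartHistory A src opp ident r t = dartHistory A src opp' ident r t) :
    dartSent A src opp ident r t = dartSent A src opp' ident r t := by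
  funext x
  rw [dartSent, dartSent, h]

theorem dartMarked_congr {A : DistAlgorithm} {src : X → Fin k} {opp opp' : X → X}
    {ident : Fin k → ℕ} {r : Fin k → ℕ → Bool} {t : ℕ}
    (h : dartHistory A src opp ident r t = dartHistory A src opp' ident r t) :
    dartMarked A src opp ident r t = dartMarked A src opp' ident r t := by
  funext x
  rw [dartMarked, dartMarked, h]

/-- Two executions agree as long as no message has been sent along a dart on which they differ. -/
theorem dartHistory_eq_of_silent {A : DistAlgorithm} {src : X → Fin k} {opp opp' : X → X}
    {ident : Fin k → ℕ} {r : Fin k → ℕ → Bool} {t : ℕ}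
    (h : ∀ t' < t, ∀ x, opp x ≠ opp' x →
      dartSent A src opp ident r t' (opp x) = none ∧
        dartSent A src opp ident r t' (opp' x) = none) :
    ∀ t' ≤ t, dartHistory A src opp ident r t' = dartHistory A src opp' ident r t' := by
  intro t' ht'
  induction t' with
  | zero => rfl
  | succ t' ih =>
    have hh := ih (by omega)
    have hs := dartSent_congr hh
    funext v
    rw [dartHistory_succ, dartHistory_succ, ← hs, hh]
    congr 1
    funext p
    -- Where the wirings differ, both executions deliver nothing through this port.
    by_cases hx : opp (portEquiv src v p).1 = opp' (portEquiv src v p).1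
    · rw [hx]
    · rw [(h t' ht' _ hx).1, (h t' ht' _ hx).2]

end Coupling

/-! ### Measurability -/

section Measurability

variable {X : Type} [Fintype X] {k : ℕ}

/-- Inboxes are finite tuples of finite strings, so there are only countably many histories to
condition on. -/
theorem measurableSet_dartSent_of_dartHistory (A : DistAlgorithm) (src : X → Fin k) (opp : X → X)
    (ident : Fin k → ℕ) (t : ℕ)
    (hh : ∀ v h, MeasurableSet {r | dartHistory A src opp ident r t v = h}) (x : X)
    (m : Option Message) : MeasurableSet {r | dartSent A src opp ident r t x = m} := by
  have : {r | dartSent A src opp ident r t x = m} =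
      ⋃ h : List (Inbox (portCount src (src x))),
        {r | dartHistory A src opp ident r t (src x) = h} ∩
          (fun r : Fin k → ℕ → Bool => r (src x)) ⁻¹'
            {ρ | A.send k (ident (src x)) (portCount src (src x)) ρ h (portIndex src x) = m} := by
    ext r
    simp [dartSent]
  rw [this]
  exact MeasurableSet.iUnion fun h =>
    (hh _ h).inter (measurable_pi_apply (src x) (A.measurableSet_send _ _ _ _ _ _))

theorem measurableSet_dartHistory (A : DistAlgorithm) (src : X → Fin k) (opp : X → X)
    (ident : Fin k → ℕ) (t : ℕ) :
    ∀ v h, MeasurableSet {r | dartHistory A src opp ident r t v = h} := by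
  induction t with
  | zero =>
    intro v h
    simp only [dartHistory]
    exact MeasurableSet.const _
  | succ t ih =>
    intro v h
    cases h with
    | nil => simp [dartHistory_succ]
    | cons f l =>
      have : {r | dartHistory A src opp ident r (t + 1) v = f :: l} =
          (⋂ p, {r | dartSent A src opp ident r t (opp (portEquiv src v p).1) = f p}) ∩
            {r | dartHistory A src opp ident r t v = l} := by
        ext r
        simp [dartHistory_succ, funext_iff]
      rw [this]
      exact (MeasurableSet.iInter fun p =>
        measurableSet_dartSent_of_dartHistory A src opp ident t ih _ _).inter (ih v l)

theorem measurableSet_dartSent (A : DistAlgorithm) (src : X → Fin k) (opp : X → X)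
    (ident : Fin k → ℕ) (t : ℕ) (x : X) (m : Option Message) :
    MeasurableSet {r | dartSent A src opp ident r t x = m} :=
  measurableSet_dartSent_of_dartHistory A src opp ident t
    (measurableSet_dartHistory A src opp ident t) x m

theorem measurableSet_dartSent_isSome (A : DistAlgorithm) (src : X → Fin k) (opp : X → X)
    (ident : Fin k → ℕ) (t : ℕ) (x : X) :
    MeasurableSet {r | (dartSent A src opp ident r t x).isSome} := by
  have : {r | (dartSent A src opp ident r t x).isSome} =
      {r | dartSent A src opp ident r t x = none}ᶜ := by
    ext r
    simp [Option.isSome_iff_ne_none]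
  rw [this]
  exact (measurableSet_dartSent A src opp ident t x none).compl

theorem measurableSet_dartMarked (A : DistAlgorithm) (src : X → Fin k) (opp : X → X)
    (ident : Fin k → ℕ) (t : ℕ) (x : X) :
    MeasurableSet {r | dartMarked A src opp ident r t x} := by
  have : {r | dartMarked A src opp ident r t x} =
      ⋃ h : List (Inbox (portCount src (src x))),
        {r | dartHistory A src opp ident r t (src x) = h} ∩
          (fun r : Fin k → ℕ → Bool => r (src x)) ⁻¹'
            {ρ | A.mark k (ident (src x)) (portCount src (src x)) ρ h (portIndex src x) = true} := by
    ext r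
    simp [dartMarked]
  rw [this]
  exact MeasurableSet.iUnion fun h => (measurableSet_dartHistory A src opp ident t _ h).inter
    (measurable_pi_apply (src x) (A.measurableSet_mark _ _ _ _ _ _))

theorem DartSystem.measurableSet_success (S : DartSystem X k) (A : DistAlgorithm) :
    MeasurableSet {r | A.Success S.toNetwork r} := by
  have hadj : ∀ t u w, MeasurableSet {r | (A.output S.toNetwork r t).Adj u w} := by
    intro t u w
    simp_rw [S.output_toNetwork_adj]
    rw [Set.ofPred_exists]
    refine MeasurableSet.iUnion fun x => ?_
    exact (MeasurableSet.const _).inter ((MeasurableSet.const _).inter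
      ((measurableSet_dartMarked _ _ _ _ _ _).union (measurableSet_dartMarked _ _ _ _ _ _)))
  have hout : ∀ t T, MeasurableSet {r | A.output S.toNetwork r t = T} := by
    intro t T
    have : {r | A.output S.toNetwork r t = T} =
        ⋂ u, ⋂ w, {r | (A.output S.toNetwork r t).Adj u w ↔ T.Adj u w} := by
      ext r
      simp [SimpleGraph.ext_iff, funext_iff]
    rw [this]
    refine MeasurableSet.iInter fun u => MeasurableSet.iInter fun w => ?_
    by_cases h : T.Adj u w
    · simpa [h] using hadj t u w
    · simp only [h, iff_false]
      exact (hadj t u w).compl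
  have : {r | A.Success S.toNetwork r} = ⋃ T : SimpleGraph (Fin k), ({_r | T.IsTree} ∩
      ⋃ t₀ : ℕ, ⋂ t : ℕ, ⋂ _ : t₀ ≤ t, {r | A.output S.toNetwork r t = T}) := by
    ext r
    simp [DistAlgorithm.Success, eventually_atTop]
  rw [this]
  exact MeasurableSet.iUnion fun T => (MeasurableSet.const _).inter <|
    MeasurableSet.iUnion fun t₀ => MeasurableSet.iInter fun t => MeasurableSet.iInter fun _ =>
      hout t T

end Measurability

/-! ### Counting -/

/-- A forest contains at most `2 * s` of the edges of a complete bipartite graph `K_{s,s}`. -/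
theorem SimpleGraph.IsAcyclic.card_bipartite_le {W : Type*} {T : SimpleGraph W} (hT : T.IsAcyclic)
    {s : ℕ} (f : Fin s ⊕ Fin s ↪ W) (B : Finset (Fin s × Fin s))
    (hB : ∀ e ∈ B, T.Adj (f (.inl e.1)) (f (.inr e.2))) : B.card ≤ 2 * s := by
  classical
  rcases B.eq_empty_or_nonempty with rfl | ⟨e₀, -⟩
  · simp
  have : Nonempty (Fin s ⊕ Fin s) := ⟨.inl e₀.1⟩
  -- The pulled-back forest extends to a spanning tree on the `2 * s` vertices, whose number of
  -- edges is known.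
  obtain ⟨F, hle, -, hF⟩ :=
    (SimpleGraph.connected_top (V := Fin s ⊕ Fin s)).exists_isTree_le_of_le_of_isAcyclic
      le_top (hT.of_comap f)
  have hcard := hF.card_edgeFinset
  have : B.card ≤ F.edgeFinset.card := by
    refine Finset.card_le_card_of_injOn (fun e => s(.inl e.1, .inr e.2)) ?_ ?_
    · intro e he
      simpa using hle (hB e he)
    · intro e _ e' _ h
      simpa [Prod.ext_iff] using h
  simp only [Fintype.card_sum, Fintype.card_fin] at hcard
  omega

/-- In an increasing family of sets, few elements appear before an eighth of all elements have. -/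
theorem card_early_le {Y : Type*} [Fintype Y] (u : ℕ → Finset Y) (hu : Monotone u) (B : Finset Y)
    (hB : ∀ e ∈ B, ∃ t, e ∈ u t ∧ 8 * (u t).card < Fintype.card Y) :
    8 * B.card ≤ Fintype.card Y := by
  choose! τ hτ using hB
  rcases B.eq_empty_or_nonempty with rfl | hne
  · simp
  -- By monotonicity, the set at the latest of the chosen times contains all of `B`.
  obtain ⟨e₀, he₀, hmax⟩ := B.exists_max_image τ hne
  have : B.card ≤ (u (τ e₀)).card :=
    Finset.card_le_card fun e he => hu (hmax e he) (hτ e he).1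
  have := (hτ e₀ he₀).2
  omega

/-- Union bound over the coordinate that lies in its set, the other one being free. -/
theorem card_exists_mem_le {Y : Type*} [Fintype Y] [DecidableEq Y] (B : Bool → Finset Y)
    (C : Finset (Bool → Y)) (hC : ∀ p ∈ C, ∃ l, p l ∈ B l) :
    C.card ≤ ((B false).card + (B true).card) * Fintype.card Y := by
  have hsub : C ⊆ Fintype.piFinset (fun l => if l = false then B false else Finset.univ) ∪
      Fintype.piFinset (fun l => if l = true then B true else Finset.univ) := by
    intro p hp
    obtain ⟨l, hl⟩ := hC p hp
    cases l <;> simp [Fintype.mem_piFinset, hl]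
  refine (Finset.card_le_card hsub).trans ((Finset.card_union_le _ _).trans ?_)
  simp [Fintype.card_piFinset, mul_add, mul_comm]

/-! ### The networks with crossed edges

There are `M` outer blocks, each a complete bipartite graph `K_{s,s}`, and a hub, a complete bipartite
graph `K_{Ms,Ms}` in which `M` blocks are singled out. Crossing an edge of the `i`-th outer block with
an edge of the `i`-th block of the hub joins the outer block to the hub and keeps all degrees. -/

/-- A vertex: whether it lies in the hub, its block, its side, its position. -/
abbrev Vertex (M s : ℕ) : Type := Bool × Fin M × Bool × Fin s

/-- An uncrossed edge: whether it lies in the hub, its two ends. Outside of the hub, the ends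
are in the same block. -/
abbrev BaseEdge (M s : ℕ) : Type :=
  {x : Bool × (Fin M × Fin s) × (Fin M × Fin s) // x.1 = false → x.2.1.1 = x.2.2.1}

/-- An edge with the side of its source. -/
abbrev BaseDart (M s : ℕ) : Type := BaseEdge M s × Bool

/-- The edges to be crossed: one of every outer block and one of every block of the hub. -/
abbrev Crossing (s : ℕ) : Type := Bool → Fin s × Fin s

section Crossed

variable {M s : ℕ}

/-- The source of a dart. -/
def source (x : BaseDart M s) : Vertex M s :=
  (x.1.1.1, (bif x.2 then x.1.1.2.2 else x.1.1.2.1).1, x.2,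
    (bif x.2 then x.1.1.2.2 else x.1.1.2.1).2)

/-- The edge `e` of the `i`-th block, in the hub or outside. -/
def blockEdge (l : Bool) (i : Fin M) (e : Fin s × Fin s) : BaseEdge M s :=
  ⟨(l, (i, e.1), (i, e.2)), fun _ => rfl⟩

/-- The permutation of the edges that determines the second ends. -/
def crossEdge (c : Fin M → Option (Crossing s)) (x : BaseEdge M s) : BaseEdge M s :=
  match c x.1.2.1.1 with
  | none => x
  | some p =>
    if x = blockEdge x.1.1 x.1.2.1.1 (p x.1.1) then blockEdge (!x.1.1) x.1.2.1.1 (p (!x.1.1)) else x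

theorem crossEdge_blockEdge {c : Fin M → Option (Crossing s)} {i : Fin M} {p : Crossing s}
    (h : c i = some p) (l : Bool) : crossEdge c (blockEdge l i (p l)) = blockEdge (!l) i (p (!l)) := by
  simp [crossEdge, blockEdge, h]

theorem crossEdge_of_forall_ne {c : Fin M → Option (Crossing s)} {x : BaseEdge M s}
    (h : ∀ l i p, c i = some p → x ≠ blockEdge l i (p l)) : crossEdge c x = x := by
  unfold crossEdge
  split
  · rfl
  · next p hp => rw [if_neg (h _ _ p hp)]

theorem crossEdge_eq_self_or (c : Fin M → Option (Crossing s)) (x : BaseEdge M s) :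
    crossEdge c x = x ∨ ∃ l i p, c i = some p ∧ x = blockEdge l i (p l) := by
  by_cases h : ∃ l i p, c i = some p ∧ x = blockEdge l i (p l)
  · exact .inr h
  · exact .inl (crossEdge_of_forall_ne fun l i p hp hx => h ⟨l, i, p, hp, hx⟩)

theorem crossEdge_crossEdge (c : Fin M → Option (Crossing s)) (x : BaseEdge M s) :
    crossEdge c (crossEdge c x) = x := by
  rcases crossEdge_eq_self_or c x with h | ⟨l, i, p, hp, rfl⟩
  · rw [h, h]
  · rw [crossEdge_blockEdge hp, crossEdge_blockEdge hp, Bool.not_not]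

theorem blockEdge_inj {l l' : Bool} {i i' : Fin M} {e e' : Fin s × Fin s} :
    blockEdge l i e = blockEdge l' i' e' ↔ l = l' ∧ i = i' ∧ e = e' := by
  simp only [blockEdge, Subtype.mk.injEq, Prod.ext_iff]
  tauto

theorem eq_of_source_eq {x y : BaseDart M s} (h : source x = source y)
    (h' : source (x.1, !x.2) = source (y.1, !y.2)) : x = y := by
  obtain ⟨⟨⟨l, a, b⟩, hx⟩, d⟩ := x
  obtain ⟨⟨⟨l', a', b'⟩, hy⟩, d'⟩ := y
  simp only [source, Prod.mk.injEq] at h h'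
  obtain ⟨rfl, h1, rfl, h2⟩ := h
  obtain ⟨-, h3, -, h4⟩ := h'
  cases d <;> simp_all [Prod.ext_iff]

/-- The reversal of the darts. -/
def crossOpp (c : Fin M → Option (Crossing s)) (x : BaseDart M s) : BaseDart M s :=
  (crossEdge c x.1, !x.2)

theorem source_blockEdge (l : Bool) (i : Fin M) (e : Fin s × Fin s) (b : Bool) :
    source (blockEdge l i e, b) = (l, i, b, bif b then e.2 else e.1) := by
  cases b <;> rfl

/-- Crossing creates no multiple edge: a crossed edge joins hub and outer block, an uncrossed one
does not, and each block on each level has only one crossed edge. -/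
theorem eq_of_source_crossOpp_eq (c : Fin M → Option (Crossing s)) {x y : BaseDart M s}
    (h : source x = source y) (h' : source (crossOpp c x) = source (crossOpp c y)) : x = y := by
  obtain ⟨x, b⟩ := x
  obtain ⟨y, b'⟩ := y
  have hb : b = b' := congrArg (fun v : Vertex M s => v.2.2.1) h
  have hl : x.1.1 = y.1.1 := congrArg (fun v : Vertex M s => v.1) h
  have hl' : (crossEdge c x).1.1 = (crossEdge c y).1.1 := congrArg (fun v : Vertex M s => v.1) h'
  subst hb
  rcases crossEdge_eq_self_or c x with hx | ⟨l, i, p, hp, rfl⟩ <;>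
    rcases crossEdge_eq_self_or c y with hy | ⟨l', i', p', hp', rfl⟩
  · simp only [crossOpp, hx, hy] at h'
    exact eq_of_source_eq h h'
  · rw [hx, hl, crossEdge_blockEdge hp'] at hl'
    simp [blockEdge] at hl'
  · rw [hy, ← hl, crossEdge_blockEdge hp] at hl'
    simp [blockEdge] at hl'
  · rw [source_blockEdge, source_blockEdge] at h
    simp only [Prod.mk.injEq] at h
    obtain ⟨rfl, rfl, -⟩ := h
    rw [hp, Option.some_inj] at hp'
    rw [hp']

variable (M s) in
/-- The number of vertices. -/
abbrev vertexCount : ℕ := Fintype.card (Vertex M s)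

theorem vertexCount_eq : vertexCount M s = 4 * (M * s) := by
  simp [vertexCount]; ring

/-- The vertices, numbered. -/
noncomputable def vertexIndex : Vertex M s ≃ Fin (vertexCount M s) := Fintype.equivFin _

/-- The source of a dart, numbered. -/
noncomputable def sourceIndex (x : BaseDart M s) : Fin (vertexCount M s) := vertexIndex (source x)

/-- The dart system with the edges of `c` crossed. -/
noncomputable def crossSystem (c : Fin M → Option (Crossing s)) :
    DartSystem (BaseDart M s) (vertexCount M s) where
  src := sourceIndex
  opp := crossOpp c
  opp_opp x := by
    obtain ⟨x, b⟩ := x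
    simp only [crossOpp, crossEdge_crossEdge, Bool.not_not]
  src_opp_ne x h := by
    have := congrArg (fun v : Vertex M s => v.2.2.1) (vertexIndex.injective h)
    simp [crossOpp, source] at this
  eq_of_src_eq x y h h' :=
    eq_of_source_crossOpp_eq c (vertexIndex.injective h) (vertexIndex.injective h')

/-- An edge that leaves an outer block is crossed. -/
theorem eq_blockEdge_of_leaves {c : Fin M → Option (Crossing s)} {i : Fin M} {x : BaseDart M s}
    (h1 : (source x).1 = false) (h2 : (source x).2.1 = i)
    (h : ¬ ((source (crossOpp c x)).1 = false ∧ (source (crossOpp c x)).2.1 = i)) :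
    ∃ p, c i = some p ∧ x.1 = blockEdge false i (p false) := by
  obtain ⟨x, b⟩ := x
  rcases crossEdge_eq_self_or c x with hx | ⟨l, j, p, hp, rfl⟩
  · refine absurd ?_ h
    have h1' : x.1.1 = false := h1
    have := x.2 h1'
    rw [crossOpp, hx]
    cases b <;> simp_all [source]
  · rw [source_blockEdge] at h1 h2
    obtain rfl : l = false := h1
    obtain rfl : j = i := h2
    exact ⟨p, hp, rfl⟩

/-- Crossing one more block rewires only the darts of its two chosen edges. -/
theorem crossOpp_update_ne {c : Fin M → Option (Crossing s)} {i : Fin M} {p : Crossing s}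
    {x : BaseDart M s}
    (h : crossOpp (Function.update c i none) x ≠ crossOpp (Function.update c i (some p)) x) :
    ∃ l, x.1 = blockEdge l i (p l) := by
  by_contra! hx
  apply h
  obtain ⟨x, b⟩ := x
  simp only [crossOpp, Prod.mk.injEq, and_true]
  rcases crossEdge_eq_self_or c x with hc | ⟨l, j, q, hq, rfl⟩
  · by_cases hi : x.1.2.1.1 = i
    · subst hi
      simp [crossEdge, hx]
    · simp [crossEdge, hi]
  · by_cases hi : j = i
    · subst hi
      have := hx l
      simp_all [crossEdge, blockEdge]
    · simp [crossEdge, hi, blockEdge]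

theorem crossEdge_update_none_blockEdge (c : Fin M → Option (Crossing s)) (i : Fin M) (l : Bool)
    (e : Fin s × Fin s) : crossEdge (Function.update c i none) (blockEdge l i e) = blockEdge l i e := by
  simp [crossEdge, blockEdge]

end Crossed

/-! ### The messages inside one block -/

section Block

variable {M s : ℕ}

/-- The message sent along a dart of the network with crossed edges. -/
noncomputable abbrev crossSent (A : DistAlgorithm) (c : Fin M → Option (Crossing s))
    (r : Fin (vertexCount M s) → ℕ → Bool) (t : ℕ) (x : BaseDart M s) : Option Message :=
  dartSent A sourceIndex (crossOpp c) DartSystem.succIdent r t x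

/-- The number of messages sent along the edges of the `i`-th blocks, outside of the hub and in it. -/
noncomputable def blockMessages (A : DistAlgorithm) (c : Fin M → Option (Crossing s))
    (i : Fin M) (r : Fin (vertexCount M s) → ℕ → Bool) : ℝ≥0∞ :=
  ∑ y : Bool × (Fin s × Fin s) × Bool, ∑' t,
    if (crossSent A c r t (blockEdge y.1 i y.2.1, y.2.2)).isSome then 1 else 0

/-- Blocks with different indices have disjoint sets of darts, so no message is counted twice. -/
theorem sum_blockMessages_le (A : DistAlgorithm) (c : Fin M → Option (Crossing s))
    (r : Fin (vertexCount M s) → ℕ → Bool) :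
    ∑ i, blockMessages A c i r ≤ A.messages (crossSystem c).toNetwork r := by
  classical
  rw [DartSystem.messages_toNetwork, Summable.tsum_finsetSum fun _ _ => ENNReal.summable]
  unfold blockMessages
  rw [← Fintype.sum_prod_type']
  have hinj : Function.Injective fun z : Fin M × Bool × (Fin s × Fin s) × Bool =>
      ((blockEdge z.2.1 z.1 z.2.2.1, z.2.2.2) : BaseDart M s) := by
    rintro ⟨i, l, e, b⟩ ⟨i', l', e', b'⟩ h
    simp only [Prod.mk.injEq, blockEdge_inj] at h
    obtain ⟨⟨rfl, rfl, rfl⟩, rfl⟩ := h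
    rfl
  rw [← Finset.sum_image (s := Finset.univ)
    (f := fun x => ∑' t, if (crossSent A c r t x).isSome then (1 : ℝ≥0∞) else 0) hinj.injOn]
  exact Finset.sum_le_sum_of_subset (Finset.subset_univ _)

theorem measurable_blockMessages (A : DistAlgorithm) (c : Fin M → Option (Crossing s))
    (i : Fin M) : Measurable (blockMessages A c i) := by
  unfold blockMessages
  refine Finset.measurable_sum _ fun y _ => Measurable.tsum fun t => ?_
  exact Measurable.ite (measurableSet_dartSent_isSome _ _ _ _ _ _) measurable_const measurable_const

variable (A : DistAlgorithm) (c : Fin M → Option (Crossing s)) (i : Fin M)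
  (r : Fin (vertexCount M s) → ℕ → Bool)

open Classical in
/-- The edges of the `i`-th block along which a message is sent in the first `t + 1` rounds, as long
as this block is not crossed. -/
noncomputable def usedEdges (t : ℕ) (l : Bool) : Finset (Fin s × Fin s) :=
  Finset.univ.filter fun e => ∃ t' ≤ t, ∃ b,
    (crossSent A (Function.update c i none) r t' (blockEdge l i e, b)).isSome

theorem usedEdges_mono (l : Bool) : Monotone fun t => usedEdges A c i r t l := by
  intro t u htu e he
  simp only [usedEdges, Finset.mem_filter, Finset.mem_univ, true_and] at he ⊢
  obtain ⟨t', ht', h⟩ := he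
  exact ⟨t', ht'.trans htu, h⟩

theorem dartHistory_update_eq {p : Crossing s} {t : ℕ}
    (h : ∀ t' < t, ∀ l, p l ∉ usedEdges A c i r t' l) :
    ∀ t' ≤ t, dartHistory A sourceIndex (crossOpp (Function.update c i none))
        DartSystem.succIdent r t' =
      dartHistory A sourceIndex (crossOpp (Function.update c i (some p)))
        DartSystem.succIdent r t' := by
  have hsil : ∀ t' < t, ∀ l b,
      crossSent A (Function.update c i none) r t' (blockEdge l i (p l), b) = none := by
    intro t' ht' l b
    by_contra hne
    refine h t' ht' l ?_
    simp only [usedEdges, Finset.mem_filter, Finset.mem_univ, true_and]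
    exact ⟨t', le_rfl, b, Option.isSome_iff_ne_none.2 hne⟩
  apply dartHistory_eq_of_silent
  rintro t' ht' ⟨x, b⟩ hx
  obtain ⟨l, rfl⟩ : ∃ l, x = blockEdge l i (p l) := crossOpp_update_ne hx
  constructor
  · rw [crossOpp, crossEdge_update_none_blockEdge]
    exact hsil t' ht' l _
  · rw [crossOpp, crossEdge_blockEdge (Function.update_self i (some p) c)]
    exact hsil t' ht' _ _

/-- The histories agree up to and including round `t`, so the messages of round `t` itself are still
common to both executions. Thus the hypothesis concerns rounds before `t` while the count includes
round `t`, possibly the round of first use. -/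
theorem card_usedEdges_le_blockMessages {p : Crossing s} {t : ℕ}
    (h : ∀ t' < t, ∀ l, p l ∉ usedEdges A c i r t' l) (l : Bool) :
    ((usedEdges A c i r t l).card : ℝ≥0∞) ≤
      blockMessages A (Function.update c i (some p)) i r := by
  classical
  have hmem : ∀ e ∈ usedEdges A c i r t l, ∃ b, ∃ t',
      (crossSent A (Function.update c i (some p)) r t' (blockEdge l i e, b)).isSome := by
    intro e he
    simp only [usedEdges, Finset.mem_filter, Finset.mem_univ, true_and] at he
    obtain ⟨t', ht', b, hb⟩ := he
    refine ⟨b, t', ?_⟩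
    rwa [crossSent, ← dartSent_congr (dartHistory_update_eq A c i r h t' ht')]
  choose! β τ hτ using hmem
  unfold blockMessages
  calc ((usedEdges A c i r t l).card : ℝ≥0∞)
      = ∑ e ∈ usedEdges A c i r t l, 1 := by simp
    _ ≤ ∑ e ∈ usedEdges A c i r t l, ∑' t',
          if (crossSent A (Function.update c i (some p)) r t' (blockEdge l i e, β e)).isSome
          then 1 else 0 := by
        refine Finset.sum_le_sum fun e he => ?_
        refine le_trans ?_ (ENNReal.le_tsum (τ e))
        rw [if_pos (hτ e he)]
    _ = ∑ y ∈ (usedEdges A c i r t l).image fun e => (l, e, β e), ∑' t',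
          if (crossSent A (Function.update c i (some p)) r t' (blockEdge y.1 i y.2.1, y.2.2)).isSome
          then 1 else 0 := by
        rw [Finset.sum_image]
        intro e _ e' _ he
        simp only [Prod.mk.injEq] at he
        exact he.2.1
    _ ≤ _ := Finset.sum_le_sum_of_subset (Finset.subset_univ _)

open Classical in
/-- The edges of the `i`-th block that are marked after `t` rounds, if this block is not crossed. -/
noncomputable def markedEdges (t : ℕ) (l : Bool) : Finset (Fin s × Fin s) :=
  Finset.univ.filter fun e => ∃ b, dartMarked A sourceIndex (crossOpp (Function.update c i none))
    DartSystem.succIdent r t (blockEdge l i e, b)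

variable {A c i r} {p : Crossing s}

/-- The tree has to leave the outer block, and only the crossed edges do. The mark may sit at either
end, hence on either level `l`. -/
theorem mem_markedEdges_of_isTree {t : ℕ}
    (hh : dartHistory A sourceIndex (crossOpp (Function.update c i none))
        DartSystem.succIdent r t =
      dartHistory A sourceIndex (crossOpp (Function.update c i (some p)))
        DartSystem.succIdent r t)
    (hT : (A.output (crossSystem (Function.update c i (some p))).toNetwork r t).IsTree) (hs : 0 < s) :
    ∃ l, p l ∈ markedEdges A c i r t l := by
  set S := crossSystem (Function.update c i (some p)) with hS
  let U : Set (Fin (vertexCount M s)) :=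
    {v | (vertexIndex.symm v).1 = false ∧ (vertexIndex.symm v).2.1 = i}
  obtain ⟨w⟩ := hT.connected.preconnected
    (vertexIndex (false, i, false, ⟨0, hs⟩)) (vertexIndex (true, i, false, ⟨0, hs⟩))
  obtain ⟨d, -, hd1, hd2⟩ := w.exists_boundary_dart U
    (by simp only [U, Set.mem_ofPred_eq, Equiv.symm_apply_apply, and_self])
    (by simp [U])
  obtain ⟨x, hx1, hx2, hm⟩ := (S.output_toNetwork_adj A r t _ _).1 d.adj
  obtain ⟨x, b⟩ := x
  have e1 : vertexIndex.symm d.fst = source (x, b) := by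
    rw [← hx1]; exact vertexIndex.symm_apply_apply _
  have e2 : vertexIndex.symm d.snd = source (crossOpp (Function.update c i (some p)) (x, b)) := by
    rw [← hx2]; exact vertexIndex.symm_apply_apply _
  simp only [U, Set.mem_ofPred_eq, e1] at hd1
  simp only [U, Set.mem_ofPred_eq, e2] at hd2
  obtain ⟨q, hq, hxq⟩ := eq_blockEdge_of_leaves hd1.1 hd1.2 hd2
  rw [Function.update_self, Option.some_inj] at hq
  subst hq
  obtain rfl : x = blockEdge false i (p false) := hxq
  have hopp : S.opp (blockEdge false i (p false), b) = (blockEdge true i (p true), !b) := by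
    change crossOpp _ _ = _
    rw [crossOpp, crossEdge_blockEdge (Function.update_self i (some p) c)]
    rfl
  rw [hopp] at hm
  have hmk := dartMarked_congr hh
  simp only [markedEdges, Finset.mem_filter, Finset.mem_univ, true_and, hmk]
  rcases hm with hm | hm
  · exact ⟨false, b, hm⟩
  · exact ⟨true, !b, hm⟩

/-- All edges of the block except `p l` are also edges of the crossed network, so those of them that
are marked form a forest; `p l` accounts for the `+ 1`. -/
theorem card_markedEdges_le {t : ℕ}
    (hh : dartHistory A sourceIndex (crossOpp (Function.update c i none))
        DartSystem.succIdent r t =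
      dartHistory A sourceIndex (crossOpp (Function.update c i (some p)))
        DartSystem.succIdent r t)
    (hT : (A.output (crossSystem (Function.update c i (some p))).toNetwork r t).IsTree) (l : Bool) :
    (markedEdges A c i r t l).card ≤ 2 * s + 1 := by
  set S := crossSystem (Function.update c i (some p)) with hS
  have hinj : Function.Injective fun z : Fin s ⊕ Fin s =>
      (vertexIndex (z.elim (fun a => (l, i, false, a)) fun a => (l, i, true, a)) :
        Fin (vertexCount M s)) := by
    refine vertexIndex.injective.comp ?_
    rintro (a | a) (b | b) h <;> simp_all
  have := hT.isAcyclic.card_bipartite_le ⟨_, hinj⟩ ((markedEdges A c i r t l).erase (p l)) ?_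
  · have := Finset.pred_card_le_card_erase (s := markedEdges A c i r t l) (a := p l)
    omega
  · intro e he
    rw [Finset.mem_erase] at he
    obtain ⟨hne, he⟩ := he
    have hmk := dartMarked_congr hh
    simp only [markedEdges, Finset.mem_filter, Finset.mem_univ, true_and, hmk] at he
    have hopp : ∀ b, S.opp (blockEdge l i e, b) = (blockEdge l i e, !b) := by
      intro b
      change crossOpp _ _ = _
      rw [crossOpp, crossEdge_of_forall_ne]
      intro l' i' q hq heq
      obtain ⟨rfl, rfl, rfl⟩ := blockEdge_inj.1 heq
      rw [Function.update_self, Option.some_inj] at hq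
      exact hne (by rw [hq])
    refine (S.output_toNetwork_adj A r t _ _).2 ⟨(blockEdge l i e, false), rfl, ?_, ?_⟩
    · rw [hopp]; rfl
    · rw [hopp]
      obtain ⟨b, hb⟩ := he
      cases b
      · exact .inl hb
      · exact .inr hb

open Classical in
variable (A c i r) in
/-- For all but half of the ways to cross the `i`-th block, the execution does not construct a
spanning tree or sends many messages inside this block. -/
theorem card_success_cheap_le (hs : 24 ≤ s) :
    2 * (Finset.univ.filter fun p : Crossing s =>
        A.Success (crossSystem (Function.update c i (some p))).toNetwork r ∧
          8 * blockMessages A (Function.update c i (some p)) i r < (s ^ 2 : ℕ)).card ≤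
      Fintype.card (Crossing s) := by
  set bad := Finset.univ.filter fun p : Crossing s =>
        A.Success (crossSystem (Function.update c i (some p))).toNetwork r ∧
          8 * blockMessages A (Function.update c i (some p)) i r < (s ^ 2 : ℕ) with hbad
  have hcardY : Fintype.card (Fin s × Fin s) = s ^ 2 := by simp [sq]
  let silent := bad.filter fun p => ∀ t l, p l ∉ usedEdges A c i r t l
  let loud := bad.filter fun p => ¬ ∀ t l, p l ∉ usedEdges A c i r t l
  have hsplit : silent.card + loud.card = bad.card := Finset.card_filter_add_card_filter_not _
  -- crossings whose edges are never used
  have hsilent : silent.card ≤ 2 * (2 * s + 1) * s ^ 2 := by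
    rcases silent.eq_empty_or_nonempty with h0 | ⟨p₀, hp₀⟩
    · simp [h0]
    have hhist : ∀ p ∈ silent, ∀ t, _ := fun p hp t =>
      dartHistory_update_eq A c i r (p := p) (t := t)
        (fun t' _ l => (Finset.mem_filter.1 hp).2 t' l) t le_rfl
    have htree : ∀ p ∈ silent, ∀ᶠ t in atTop,
        (A.output (crossSystem (Function.update c i (some p))).toNetwork r t).IsTree := by
      intro p hp
      obtain ⟨T, hT, hev⟩ := (Finset.mem_filter.1 (Finset.mem_filter.1 hp).1).2.1
      filter_upwards [hev] with t ht
      rwa [ht]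
    -- There are finitely many silent crossings, so one round serves them all; the marked edges at
    -- that round are those of the reference execution and do not depend on `p`.
    obtain ⟨t, ht⟩ := ((silent.eventually_all).2 htree).exists
    -- Every silent crossing hits the common marked set, whose size is bounded by means of the
    -- single crossing `p₀`.
    have h1 := card_exists_mem_le (markedEdges A c i r t) silent fun p hp =>
      mem_markedEdges_of_isTree (hhist p hp t) (ht p hp) (by omega)
    have h2 := card_markedEdges_le (hhist p₀ hp₀ t) (ht p₀ hp₀) false
    have h3 := card_markedEdges_le (hhist p₀ hp₀ t) (ht p₀ hp₀) true
    rw [hcardY] at h1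
    refine h1.trans (Nat.mul_le_mul_right _ ?_)
    omega
  -- crossings whose edges are used early
  have hloud : 4 * loud.card ≤ s ^ 2 * s ^ 2 := by
    let early : Bool → Finset (Fin s × Fin s) := fun l => Finset.univ.filter fun e =>
      ∃ t, e ∈ usedEdges A c i r t l ∧ 8 * (usedEdges A c i r t l).card < s ^ 2
    have hearly : ∀ l, 8 * (early l).card ≤ s ^ 2 := by
      intro l
      rw [← hcardY]
      refine card_early_le _ (usedEdges_mono A c i r l) _ fun e he => ?_
      rw [hcardY]
      exact (Finset.mem_filter.1 he).2
    have h1 := card_exists_mem_le early loud ?_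
    · rw [hcardY] at h1
      have := hearly false
      have := hearly true
      nlinarith
    · intro p hp
      obtain ⟨hpb, hp⟩ := Finset.mem_filter.1 hp
      push Not at hp
      have hex : ∃ t, ∃ l, p l ∈ usedEdges A c i r t l := hp
      -- At the first use of a crossed edge the reference execution is still valid, so cheapness
      -- bounds the number of edges used by then.
      obtain ⟨l, hl⟩ := Nat.find_spec hex
      refine ⟨l, Finset.mem_filter.2 ⟨Finset.mem_univ _, Nat.find hex, hl, ?_⟩⟩
      have hle := card_usedEdges_le_blockMessages A c i r (p := p) (t := Nat.find hex)
        (fun t' ht' l hm => Nat.find_min hex ht' ⟨l, hm⟩) l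
      have hlt := (Finset.mem_filter.1 hpb).2.2
      have := (mul_le_mul_right hle 8).trans_lt hlt
      exact_mod_cast this
  have hcard : Fintype.card (Crossing s) = s ^ 2 * s ^ 2 := by
    simp [Crossing, sq]
  rw [hcard, ← hsplit]
  -- Silent and loud crossings each make up at most a quarter of all `s ^ 4`; for the silent ones
  -- this is `8 * (2 * s + 1) ≤ s ^ 2`.
  nlinarith [Nat.mul_le_mul_right (s ^ 2) (show 8 * (2 * s + 1) ≤ s ^ 2 by nlinarith)]

end Block

/-! ### Averaging over the crossings -/

open Classical in
-- Fubini for counting: fix all coordinates but `i`, and sum the bound over the fibres.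
theorem two_mul_card_filter_le_of_update {ι β : Type*} [Fintype ι] [DecidableEq ι] [Fintype β]
    [Nonempty β] (i : ι) (Q : (ι → β) → Prop)
    (h : ∀ c, 2 * (Finset.univ.filter fun p => Q (Function.update c i p)).card ≤ Fintype.card β) :
    2 * (Finset.univ.filter Q).card ≤ Fintype.card (ι → β) := by
  obtain ⟨p₀⟩ := ‹Nonempty β›
  have hE : ∀ p d, (Equiv.piSplitAt i fun _ => β).symm (p, d) =
      Function.update ((Equiv.piSplitAt i fun _ => β).symm (p₀, d)) i p := by
    intro p d
    funext j
    by_cases hj : j = i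
    · subst hj
      rw [Function.update_self]
      exact dif_pos rfl
    · have hd : ∀ q, (Equiv.piSplitAt i fun _ => β).symm (q, d) j = d ⟨j, hj⟩ := fun q => dif_neg hj
      rw [Function.update_of_ne hj, hd, hd]
  rw [Finset.card_filter, ← (Equiv.piSplitAt i fun _ => β).symm.sum_comp,
    Fintype.sum_prod_type_right, Fintype.card_congr (Equiv.piSplitAt i fun _ => β),
    Fintype.card_prod, Finset.mul_sum]
  refine (Finset.sum_le_card_nsmul _ _ (Fintype.card β) fun d _ => ?_).trans ?_
  · refine le_trans (le_of_eq ?_) (h ((Equiv.piSplitAt i fun _ => β).symm (p₀, d)))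
    rw [Finset.card_filter]
    congr 1
    exact Finset.sum_congr rfl fun p _ => by rw [hE]
  · rw [Finset.card_univ, smul_eq_mul, mul_comm]

instance isProbabilityMeasure_coinFlips : IsProbabilityMeasure coinFlips := by
  unfold coinFlips
  infer_instance

instance isProbabilityMeasure_nodeCoins (n : ℕ) : IsProbabilityMeasure (nodeCoins n) := by
  unfold nodeCoins
  infer_instance

section Averaging

variable {M s : ℕ}

/-- The dart system in which every block is crossed. -/
noncomputable abbrev fullCrossSystem (c : Fin M → Crossing s) :
    DartSystem (BaseDart M s) (vertexCount M s) :=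
  crossSystem fun i => some (c i)

theorem update_some {ι β : Type*} [DecidableEq ι] (c : ι → β) (i : ι) (p : β) :
    (fun j => some (Function.update c i p j)) =
      Function.update (fun j => some (c j)) i (some p) := by
  funext j
  by_cases hj : j = i
  · subst hj; simp
  · simp [hj]

/-- For fixed coins at most half of the crossings are bad, so the mean probability of `bad` is at
most `1/2`. Since `bad` and `good` cover success, `good` has mean probability at least `3/4 - 1/2 =
1/4`, and Markov's inequality gives the mean `s^2 / 32`. -/
theorem card_le_sum_blockMessages (A : DistAlgorithm) (hs : 24 ≤ s)
    (hA : ∀ c : Fin M → Crossing s,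
      3 / 4 ≤ nodeCoins _ {r | A.Success (fullCrossSystem c).toNetwork r}) (i : Fin M) :
    ((s ^ 2 : ℕ) : ℝ≥0∞) * Fintype.card (Fin M → Crossing s) ≤
      32 * ∑ c : Fin M → Crossing s,
        ∫⁻ r, blockMessages A (fun j => some (c j)) i r ∂(nodeCoins _) := by
  have hne : Nonempty (Crossing s) := ⟨fun _ => (⟨0, by omega⟩, ⟨0, by omega⟩)⟩
  set μ := nodeCoins (vertexCount M s)
  set N : ℝ≥0∞ := ((Fintype.card (Fin M → Crossing s) : ℕ) : ℝ≥0∞) with hN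
  let good : (Fin M → Crossing s) → Set (Fin (vertexCount M s) → ℕ → Bool) := fun c =>
    {r | ((s ^ 2 : ℕ) : ℝ≥0∞) ≤ 8 * blockMessages A (fun j => some (c j)) i r}
  let bad : (Fin M → Crossing s) → Set (Fin (vertexCount M s) → ℕ → Bool) := fun c =>
    {r | A.Success (fullCrossSystem c).toNetwork r ∧
      8 * blockMessages A (fun j => some (c j)) i r < (s ^ 2 : ℕ)}
  have hmeas : ∀ c : Fin M → Crossing s, Measurable fun r =>
      8 * blockMessages A (fun j => some (c j)) i r := fun c =>
    (measurable_blockMessages A _ i).const_mul 8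
  have hbadm : ∀ c, MeasurableSet (bad c) := fun c =>
    ((fullCrossSystem c).measurableSet_success A).inter
      (measurableSet_lt (hmeas c) measurable_const)
  classical
  have hcount : ∀ r, 2 * ∑ c, (bad c).indicator (fun _ => (1 : ℝ≥0∞)) r ≤ N := by
    intro r
    have h := two_mul_card_filter_le_of_update (β := Crossing s) i
      (fun c : Fin M → Crossing s => r ∈ bad c) ?_
    · have hind : ∑ c, (bad c).indicator (fun _ => (1 : ℝ≥0∞)) r =
          ((Finset.univ.filter fun c => r ∈ bad c).card : ℝ≥0∞) := by
        rw [Finset.card_filter, Nat.cast_sum]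
        refine Finset.sum_congr rfl fun c _ => ?_
        rw [Set.indicator_apply]
        split_ifs <;> simp
      have h' := (Nat.cast_le (α := ℝ≥0∞)).2 h
      rw [Nat.cast_mul, Nat.cast_ofNat] at h'
      rw [hind, hN]
      refine le_trans (le_of_eq ?_) (h'.trans (le_of_eq ?_)) <;> congr!
    · intro c
      have := card_success_cheap_le A (fun j => some (c j)) i r hs
      simp only [bad, Set.mem_ofPred_eq, update_some, fullCrossSystem]
      exact this
  have hbad : 2 * ∑ c, μ (bad c) ≤ N := by
    calc 2 * ∑ c, μ (bad c)
        = ∫⁻ r, 2 * ∑ c, (bad c).indicator (fun _ => (1 : ℝ≥0∞)) r ∂μ := by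
          rw [lintegral_const_mul _ (Finset.measurable_sum _ fun c _ =>
            measurable_const.indicator (hbadm c)),
            lintegral_finsetSum _ fun c _ => measurable_const.indicator (hbadm c)]
          simp_rw [lintegral_indicator_const (hbadm _), one_mul]
      _ ≤ ∫⁻ _, N ∂μ := lintegral_mono hcount
      _ = N := by simp
  have hgood : ∀ c, ((s ^ 2 : ℕ) : ℝ≥0∞) * μ (good c) ≤
      8 * ∫⁻ r, blockMessages A (fun j => some (c j)) i r ∂μ := by
    intro c
    rw [← lintegral_const_mul _ (measurable_blockMessages A _ i)]
    exact mul_meas_ge_le_lintegral (hmeas c) _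
  have hcover : ∀ c, 3 / 4 ≤ μ (bad c) + μ (good c) := by
    intro c
    refine (hA c).trans ((measure_mono ?_).trans (measure_union_le _ _))
    intro r hr
    rcases lt_or_ge (8 * blockMessages A (fun j => some (c j)) i r) ((s ^ 2 : ℕ) : ℝ≥0∞) with h | h
    · exact .inl ⟨hr, h⟩
    · exact .inr h
  have hsum : N * (3 / 4) ≤ ∑ c, μ (bad c) + ∑ c, μ (good c) := by
    rw [← Finset.sum_add_distrib, hN, ← Finset.card_univ, ← nsmul_eq_mul]
    exact Finset.card_nsmul_le_sum _ _ _ fun c _ => hcover c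
  have hN_top : N ≠ ⊤ := ENNReal.natCast_ne_top _
  have hNle : N ≤ 4 * ∑ c, μ (good c) := by
    have h1 : N * 3 ≤ 4 * ∑ c, μ (bad c) + 4 * ∑ c, μ (good c) := by
      calc N * 3 = 4 * (N * (3 / 4)) := by
            rw [mul_left_comm, ENNReal.mul_div_cancel (by norm_num) (by norm_num)]
        _ ≤ _ := by rw [← mul_add]; gcongr
    have h2 : 4 * ∑ c, μ (bad c) ≤ 2 * N := by
      calc 4 * ∑ c, μ (bad c) = 2 * (2 * ∑ c, μ (bad c)) := by rw [← mul_assoc]; norm_num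
        _ ≤ _ := by gcongr
    have h3 : 2 * N + N ≤ 2 * N + 4 * ∑ c, μ (good c) := by
      calc 2 * N + N = N * 3 := by ring
        _ ≤ _ := h1.trans (by gcongr)
    exact (ENNReal.add_le_add_iff_left (ENNReal.mul_ne_top (by norm_num) hN_top)).1 h3
  calc ((s ^ 2 : ℕ) : ℝ≥0∞) * N ≤ (s ^ 2 : ℕ) * (4 * ∑ c, μ (good c)) := by gcongr
    _ = 4 * ∑ c, (s ^ 2 : ℕ) * μ (good c) := by rw [mul_left_comm, Finset.mul_sum]
    _ ≤ 4 * ∑ c : Fin M → Crossing s, 8 * ∫⁻ r, blockMessages A (fun j => some (c j)) i r ∂μ := by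
        refine mul_le_mul_right (Finset.sum_le_sum fun c _ => hgood c) _
    _ = _ := by rw [← Finset.mul_sum, ← mul_assoc]; norm_num

/-- Some way to cross the blocks makes the algorithm send many messages. -/
theorem exists_le_expectedMessages (A : DistAlgorithm) (hs : 24 ≤ s)
    (hA : ∀ c : Fin M → Crossing s,
      3 / 4 ≤ nodeCoins _ {r | A.Success (fullCrossSystem c).toNetwork r}) :
    ∃ c : Fin M → Crossing s,
      ((M * s ^ 2 : ℕ) : ℝ≥0∞) ≤ 32 * A.expectedMessages (fullCrossSystem c).toNetwork := by
  have hne : Nonempty (Fin M → Crossing s) := ⟨fun _ _ => (⟨0, by omega⟩, ⟨0, by omega⟩)⟩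
  have htot : ((M * s ^ 2 : ℕ) : ℝ≥0∞) * Fintype.card (Fin M → Crossing s) ≤
      ∑ c : Fin M → Crossing s, 32 * A.expectedMessages (fullCrossSystem c).toNetwork := by
    calc ((M * s ^ 2 : ℕ) : ℝ≥0∞) * Fintype.card (Fin M → Crossing s)
        = ∑ _i : Fin M, ((s ^ 2 : ℕ) : ℝ≥0∞) * Fintype.card (Fin M → Crossing s) := by
          simp [mul_assoc]
      _ ≤ ∑ i : Fin M, 32 * ∑ c : Fin M → Crossing s,
            ∫⁻ r, blockMessages A (fun j => some (c j)) i r ∂(nodeCoins _) :=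
          Finset.sum_le_sum fun i _ => card_le_sum_blockMessages A hs hA i
      _ = ∑ c : Fin M → Crossing s, 32 *
            ∫⁻ r, ∑ i, blockMessages A (fun j => some (c j)) i r ∂(nodeCoins _) := by
          rw [← Finset.mul_sum, ← Finset.mul_sum, Finset.sum_comm]
          congr 1
          refine Finset.sum_congr rfl fun c _ => ?_
          rw [lintegral_finsetSum _ fun i _ => measurable_blockMessages A _ i]
      _ ≤ _ := by
          gcongr with c
          exact lintegral_mono fun r => sum_blockMessages_le A _ r
  by_contra! hlt
  refine absurd htot (not_le.2 ?_)
  refine (ENNReal.sum_lt_sum_of_nonempty Finset.univ_nonempty fun c _ => hlt c).trans_eq ?_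
  simp [mul_comm]

end Averaging

/-! ### Conductance of the crossed networks -/

section Conductance

variable {M s : ℕ}

open Classical in
/-- The darts that start in `W`. -/
noncomputable def volumeDarts (W : Finset (Vertex M s)) : Finset (BaseDart M s) :=
  Finset.univ.filter fun x => source x ∈ W

open Classical in
/-- The darts that lead out of `W`. -/
noncomputable def cutDarts (c : Fin M → Crossing s) (W : Finset (Vertex M s)) :
    Finset (BaseDart M s) :=
  Finset.univ.filter fun x => source x ∈ W ∧ source (crossOpp (fun i => some (c i)) x) ∉ W

theorem mem_cutDarts {c : Fin M → Crossing s} {W : Finset (Vertex M s)} {x : BaseDart M s} :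
    x ∈ cutDarts c W ↔ source x ∈ W ∧ source (crossOpp (fun i => some (c i)) x) ∉ W := by
  simp [cutDarts]

theorem card_cutDarts_compl (c : Fin M → Crossing s) (W : Finset (Vertex M s)) :
    (cutDarts c Wᶜ).card = (cutDarts c W).card := by
  have hopp := (fullCrossSystem c).opp_opp
  change ∀ x, crossOpp (fun i => some (c i)) (crossOpp (fun i => some (c i)) x) = x at hopp
  refine Finset.card_nbij' (crossOpp fun i => some (c i)) (crossOpp fun i => some (c i)) ?_ ?_
    (fun x _ => hopp x) (fun x _ => hopp x)
  · intro x hx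
    simp only [Finset.mem_coe, mem_cutDarts, Finset.mem_compl, not_not, hopp] at hx ⊢
    exact hx.symm
  · intro x hx
    simp only [Finset.mem_coe, mem_cutDarts, Finset.mem_compl, not_not, hopp] at hx ⊢
    exact hx.symm

open Classical in
/-- The vertices of `W` on one side of the hub. -/
noncomputable def hubPart (W : Finset (Vertex M s)) (b : Bool) : Finset (Fin M × Fin s) :=
  Finset.univ.filter fun a => (true, a.1, b, a.2) ∈ W

theorem mem_hubPart {W : Finset (Vertex M s)} {b : Bool} {a : Fin M × Fin s} :
    a ∈ hubPart W b ↔ (true, a.1, b, a.2) ∈ W := by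
  simp [hubPart]

/-- The hub edge with the given ends. -/
def hubEdge (a b : Fin M × Fin s) : BaseEdge M s := ⟨(true, a, b), fun h => by simp at h⟩

theorem crossEdge_hubEdge_of_ne_left (c : Fin M → Crossing s) {a b : Fin M × Fin s}
    (h : b ≠ (a.1, (c a.1 true).2)) : crossEdge (fun i => some (c i)) (hubEdge a b) = hubEdge a b := by
  apply crossEdge_of_forall_ne
  rintro l i p hp he
  obtain rfl := Option.some_inj.1 hp
  simp only [hubEdge, blockEdge, Subtype.mk.injEq, Prod.mk.injEq] at he
  obtain ⟨rfl, rfl, rfl⟩ := he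
  exact h rfl

theorem crossEdge_hubEdge_of_ne_right (c : Fin M → Crossing s) {a b : Fin M × Fin s}
    (h : a ≠ (b.1, (c b.1 true).1)) : crossEdge (fun i => some (c i)) (hubEdge a b) = hubEdge a b := by
  apply crossEdge_of_forall_ne
  rintro l i p hp he
  obtain rfl := Option.some_inj.1 hp
  simp only [hubEdge, blockEdge, Subtype.mk.injEq, Prod.mk.injEq] at he
  obtain ⟨rfl, rfl, rfl⟩ := he
  exact h rfl

theorem card_graph_filter_le {α β : Type*} [DecidableEq α] [DecidableEq β] (f : α → β)
    (A : Finset α) (B : Finset β) :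
    A.card * B.card ≤ ((A ×ˢ B).filter fun z => z.2 ≠ f z.1).card + A.card := by
  rw [← Finset.card_product, ← Finset.card_filter_add_card_filter_not (s := A ×ˢ B)
    (fun z => z.2 ≠ f z.1)]
  refine Nat.add_le_add_left (Finset.card_le_card_of_injOn Prod.fst ?_ ?_) _
  · intro z hz
    simp only [Finset.coe_filter, Set.mem_ofPred_eq, Finset.mem_product] at hz
    exact hz.1.1
  · intro z hz z' hz' h
    simp only [Finset.coe_filter, Set.mem_ofPred_eq, not_not] at hz hz'
    exact Prod.ext h (by rw [hz.2, hz'.2, h])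

/-- The left side counts the cut in the complete bipartite hub. Each hub vertex lies on at most one
crossed edge, which is discarded; this costs at most one edge per hub vertex of `W`. -/
theorem hub_cut_le (c : Fin M → Crossing s) (W : Finset (Vertex M s)) :
    (hubPart W false).card * (hubPart W true)ᶜ.card +
        (hubPart W true).card * (hubPart W false)ᶜ.card ≤
      (cutDarts c W).card + ((hubPart W false).card + (hubPart W true).card) := by
  classical
  have h0 := card_graph_filter_le (fun a : Fin M × Fin s => (a.1, (c a.1 true).2))
    (hubPart W false) (hubPart W true)ᶜ
  have h1 := card_graph_filter_le (fun a : Fin M × Fin s => (a.1, (c a.1 true).1))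
    (hubPart W true) (hubPart W false)ᶜ
  set F0 := (hubPart W false ×ˢ (hubPart W true)ᶜ).filter fun z => z.2 ≠ (z.1.1, (c z.1.1 true).2)
  set F1 := (hubPart W true ×ˢ (hubPart W false)ᶜ).filter fun z => z.2 ≠ (z.1.1, (c z.1.1 true).1)
  have h2 : F0.card + F1.card ≤ (cutDarts c W).card := by
    rw [← Finset.card_disjSum]
    refine Finset.card_le_card_of_injOn
      (Sum.elim (fun z => (hubEdge z.1 z.2, false)) fun z => (hubEdge z.2 z.1, true)) ?_ ?_
    · rintro (⟨a, b⟩ | ⟨b, a⟩) hz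
      · simp only [Finset.mem_coe, Finset.inl_mem_disjSum, F0, Finset.mem_filter,
          Finset.mem_product, Finset.mem_compl, mem_hubPart] at hz
        simp only [Finset.mem_coe, mem_cutDarts, Sum.elim_inl, crossOpp,
          crossEdge_hubEdge_of_ne_left c hz.2]
        exact hz.1
      · simp only [Finset.mem_coe, Finset.inr_mem_disjSum, F1, Finset.mem_filter,
          Finset.mem_product, Finset.mem_compl, mem_hubPart] at hz
        simp only [Finset.mem_coe, mem_cutDarts, Sum.elim_inr, crossOpp,
          crossEdge_hubEdge_of_ne_right c hz.2]
        exact hz.1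
    · rintro (⟨a, b⟩ | ⟨b, a⟩) _ (⟨a', b'⟩ | ⟨b', a'⟩) _ h <;> simp_all [hubEdge]
  omega

/-- Crossing keeps degrees, so every hub vertex has degree `M * s`. -/
theorem card_volumeDarts_hub_le (W : Finset (Vertex M s)) :
    ((volumeDarts W).filter fun x => x.1.1.1 = true).card ≤
      ((hubPart W false).card + (hubPart W true).card) * (M * s) := by
  have : ((hubPart W false).card + (hubPart W true).card) * (M * s) =
      ((hubPart W false ×ˢ Finset.univ).disjSum (hubPart W true ×ˢ Finset.univ) :
        Finset ((Fin M × Fin s) × (Fin M × Fin s) ⊕ (Fin M × Fin s) × (Fin M × Fin s))).card := by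
    simp [Finset.card_disjSum, add_mul]
  rw [this]
  refine Finset.card_le_card_of_injOn (fun x => bif x.2 then .inr (x.1.1.2.2, x.1.1.2.1) else
    .inl (x.1.1.2.1, x.1.1.2.2)) ?_ ?_
  · rintro ⟨⟨⟨l, a, b⟩, hx⟩, d⟩ h
    obtain ⟨h, rfl : l = true⟩ := Finset.mem_filter.1 h
    have h := (Finset.mem_filter.1 h).2
    cases d <;> simpa [mem_hubPart, source] using h
  · rintro ⟨⟨⟨l, a, b⟩, hx⟩, d⟩ h ⟨⟨⟨l', a', b'⟩, hx'⟩, d'⟩ h' heq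
    have hl : l = true := (Finset.mem_filter.1 h).2
    have hl' : l' = true := (Finset.mem_filter.1 h').2
    subst hl hl'
    cases d <;> cases d' <;> simp_all

open Classical in
/-- The outer blocks that meet `W`. -/
noncomputable def outerPart (W : Finset (Vertex M s)) : Finset (Fin M) :=
  Finset.univ.filter fun i => ∃ d a, (false, i, d, a) ∈ W

theorem card_volumeDarts_outer_le (W : Finset (Vertex M s)) :
    ((volumeDarts W).filter fun x => ¬ x.1.1.1 = true).card ≤
      (outerPart W).card * (2 * s ^ 2) := by
  have : (outerPart W).card * (2 * s ^ 2) =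
      (outerPart W ×ˢ (Finset.univ : Finset (Bool × Fin s × Fin s))).card := by
    simp [sq]
  rw [this]
  refine Finset.card_le_card_of_injOn
    (fun x => (x.1.1.2.1.1, x.2, x.1.1.2.1.2, x.1.1.2.2.2)) ?_ ?_
  · rintro ⟨⟨⟨l, ⟨i, a⟩, ⟨j, b⟩⟩, hx⟩, d⟩ h
    obtain ⟨h, hl⟩ := Finset.mem_filter.1 h
    obtain rfl : l = false := by simpa using hl
    have h := (Finset.mem_filter.1 h).2
    obtain rfl : i = j := hx rfl
    simp only [Finset.mem_coe, Finset.mem_product, Finset.mem_univ, and_true, outerPart,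
      Finset.mem_filter, true_and]
    cases d
    · exact ⟨_, _, h⟩
    · exact ⟨_, _, h⟩
  · rintro ⟨⟨⟨l, ⟨i, a⟩, ⟨j, b⟩⟩, hx⟩, d⟩ h ⟨⟨⟨l', ⟨i', a'⟩, ⟨j', b'⟩⟩, hx'⟩, d'⟩ h' heq
    have hl : l = false := by simpa using (Finset.mem_filter.1 h).2
    have hl' : l' = false := by simpa using (Finset.mem_filter.1 h').2
    subst hl hl'
    obtain rfl : i = j := hx rfl
    obtain rfl : i' = j' := hx' rfl
    simp_all

/-- A set that meets an outer block is left by an edge of this block or contains a vertex of the hub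
that is joined to it. -/
theorem exists_cutDart_of_mem_outerPart (hs : 2 ≤ s) (c : Fin M → Crossing s)
    {W : Finset (Vertex M s)} {i : Fin M} (hi : i ∈ outerPart W) :
    (∃ x ∈ cutDarts c W, x.1.1.2.1.1 = i) ∨ (i, (c i true).1) ∈ hubPart W false := by
  classical
  by_contra! hcon
  obtain ⟨hcut, hhub⟩ := hcon
  have : Nontrivial (Fin s) := Fin.nontrivial_iff_two_le.2 hs
  have hedge : ∀ a b, (a, b) ≠ c i false →
      ((false, i, false, a) ∈ W ↔ (false, i, true, b) ∈ W) := by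
    intro a b hab
    have hopp : ∀ d, crossOpp (fun i => some (c i)) (blockEdge false i (a, b), d) =
        (blockEdge false i (a, b), !d) := by
      intro d
      rw [crossOpp, crossEdge_of_forall_ne]
      rintro l j p hp he
      obtain rfl := Option.some_inj.1 hp
      obtain ⟨rfl, rfl, he⟩ := blockEdge_inj.1 he
      exact hab he
    have hno : ∀ d, source (blockEdge false i (a, b), d) ∈ W →
        source (blockEdge false i (a, b), !d) ∈ W := by
      intro d hd
      by_contra hd'
      exact hcut (blockEdge false i (a, b), d) (mem_cutDarts.2 ⟨hd, by rwa [hopp]⟩) rfl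
    exact ⟨hno false, hno true⟩
  -- `K_{s,s}` minus the crossed edge is connected through any `a₀`, `b₀` that avoid its ends, so an
  -- uncut block meeting `W` lies in `W`; then its crossed edge leads out of `W` unless its hub end
  -- is in `W`.
  obtain ⟨a₀, ha₀⟩ := exists_ne (c i false).1
  obtain ⟨b₀, hb₀⟩ := exists_ne (c i false).2
  have hA : ∀ a, (a, b₀) ≠ c i false := fun a h => hb₀ (by rw [← h])
  have hB : ∀ b, (a₀, b) ≠ c i false := fun b h => ha₀ (by rw [← h])
  obtain ⟨d, a, ha⟩ := (Finset.mem_filter.1 hi).2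
  have hb₀W : (false, i, true, b₀) ∈ W := by
    cases d
    · exact (hedge a b₀ (hA a)).1 ha
    · exact (hedge a₀ b₀ (hA a₀)).1 ((hedge a₀ a (hB a)).2 ha)
  have hall : ∀ b, (false, i, true, b) ∈ W := fun b =>
    (hedge a₀ b (hB b)).1 ((hedge a₀ b₀ (hA a₀)).2 hb₀W)
  refine hcut (blockEdge false i (c i false), true) (mem_cutDarts.2 ⟨hall _, ?_⟩) rfl
  rw [crossOpp, crossEdge_blockEdge (c := fun i => some (c i)) rfl]
  exact fun h => hhub (mem_hubPart.2 h)

/-- Each outer block is charged to a cut dart or a hub vertex carrying the same block index. -/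
theorem card_outerPart_le (hs : 2 ≤ s) (c : Fin M → Crossing s) (W : Finset (Vertex M s)) :
    (outerPart W).card ≤ (cutDarts c W).card + (hubPart W false).card := by
  classical
  have hsub : outerPart W ⊆ (cutDarts c W).image (fun x => x.1.1.2.1.1) ∪
      (hubPart W false).image Prod.fst := by
    intro i hi
    rw [Finset.mem_union, Finset.mem_image, Finset.mem_image]
    exact (exists_cutDart_of_mem_outerPart hs c hi).imp id fun h => ⟨_, h, rfl⟩
  exact (Finset.card_le_card hsub).trans ((Finset.card_union_le _ _).trans
    (Nat.add_le_add Finset.card_image_le Finset.card_image_le))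

/-- When `W` holds at most half of the hub, the expansion of the hub bounds its hub volume by `4`
times the cut. Every outer block meeting `W` is charged to the cut or to one of these few hub
vertices, and contributes at most `2 * s ^ 2`. -/
theorem card_volumeDarts_le (hM : 1 ≤ M) (hs : 24 ≤ s) (c : Fin M → Crossing s)
    (W : Finset (Vertex M s))
    (hW : (hubPart W false).card + (hubPart W true).card ≤ M * s) :
    (volumeDarts W).card ≤ 5 * s ^ 2 * (cutDarts c W).card := by
  have h1 := hub_cut_le c W
  have h2 := card_volumeDarts_hub_le W
  have h3 := card_volumeDarts_outer_le W
  have h4 := card_outerPart_le (by omega) c W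
  have h5 := Finset.card_filter_add_card_filter_not (s := volumeDarts W) fun x => x.1.1.1 = true
  have h6 := Finset.card_add_card_compl (hubPart W false)
  have h7 := Finset.card_add_card_compl (hubPart W true)
  simp only [Fintype.card_prod, Fintype.card_fin] at h6 h7
  have hL : 24 ≤ M * s := hs.trans (Nat.le_mul_of_pos_left s hM)
  generalize (hubPart W false).card = p at *
  generalize (hubPart W true).card = q at *
  generalize (hubPart W false)ᶜ.card = p' at *
  generalize (hubPart W true)ᶜ.card = q' at *
  generalize (outerPart W).card = o at *
  generalize (cutDarts c W).card = z at *
  generalize M * s = L at *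
  -- The full hub cut is `(p + q) * L - 2 * p * q ≥ (p + q) * L / 2`, and the discarded `p + q`
  -- edges are at most `(p + q) * L / 24`.
  have h8 : (p + q) * L ≤ 4 * z := by
    have e1 : p * q' + p * q = p * L := by rw [← Nat.mul_add]; congr 1; omega
    have e2 : q * p' + q * p = q * L := by rw [← Nat.mul_add]; congr 1; omega
    have e3 : (p + q) * (p + q) ≤ (p + q) * L := Nat.mul_le_mul_left _ hW
    have e4 : 4 * (p * q) ≤ (p + q) * (p + q) := by nlinarith [sq_nonneg ((p : ℤ) - q)]
    have e5 : 24 * (p + q) ≤ (p + q) * L := by nlinarith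
    have e6 : q * p = p * q := mul_comm _ _
    have e7 : (p + q) * L = p * L + q * L := add_mul _ _ _
    omega
  have h9 : p + q ≤ z := by nlinarith
  have h10 : o ≤ 2 * z := by omega
  have h11 : o * (2 * s ^ 2) ≤ 2 * z * (2 * s ^ 2) := Nat.mul_le_mul_right _ h10
  have h12 : 4 * z ≤ s ^ 2 * z := Nat.mul_le_mul_right _ (by nlinarith)
  nlinarith

/-! ### Lower bound on the conductance, and connectedness -/

/-- The vertices with numbers in `U`. -/
noncomputable def unindex (U : Finset (Fin (vertexCount M s))) : Finset (Vertex M s) :=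
  U.map vertexIndex.symm.toEmbedding

theorem mem_unindex {U : Finset (Fin (vertexCount M s))} {v : Vertex M s} :
    v ∈ unindex U ↔ vertexIndex v ∈ U := by
  simp [unindex, Finset.mem_map_equiv]

theorem unindex_compl (U : Finset (Fin (vertexCount M s))) : unindex Uᶜ = (unindex U)ᶜ := by
  ext v
  simp [mem_unindex]

theorem volumeOf_fullCrossSystem (c : Fin M → Crossing s) (U : Finset (Fin (vertexCount M s))) :
    volumeOf (fullCrossSystem c).toGraph U = (volumeDarts (unindex U)).card := by
  rw [DartSystem.volumeOf_toGraph, volumeDarts]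
  simp only [mem_unindex]
  rfl

theorem cutSize_fullCrossSystem (c : Fin M → Crossing s) (U : Finset (Fin (vertexCount M s))) :
    cutSize (fullCrossSystem c).toGraph U = (cutDarts c (unindex U)).card := by
  rw [DartSystem.cutSize_toGraph, cutDarts]
  simp only [mem_unindex]
  rfl

theorem hubPart_compl (W : Finset (Vertex M s)) (b : Bool) :
    hubPart Wᶜ b = (hubPart W b)ᶜ := by
  ext a
  simp [mem_hubPart]

/-- One of the two sides holds at most half of the hub. -/
theorem min_volumeOf_le (hM : 1 ≤ M) (hs : 24 ≤ s) (c : Fin M → Crossing s)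
    (U : Finset (Fin (vertexCount M s))) :
    min (volumeOf (fullCrossSystem c).toGraph U) (volumeOf (fullCrossSystem c).toGraph Uᶜ) ≤
      5 * s ^ 2 * cutSize (fullCrossSystem c).toGraph U := by
  rw [volumeOf_fullCrossSystem, volumeOf_fullCrossSystem, cutSize_fullCrossSystem, unindex_compl]
  set W := unindex U
  by_cases hW : (hubPart W false).card + (hubPart W true).card ≤ M * s
  · exact (min_le_left _ _).trans (card_volumeDarts_le hM hs c W hW)
  · refine (min_le_right _ _).trans ?_
    rw [← card_cutDarts_compl c W]
    apply card_volumeDarts_le hM hs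
    rw [hubPart_compl, hubPart_compl, Finset.card_compl, Finset.card_compl]
    simp only [Fintype.card_prod, Fintype.card_fin]
    omega

theorem volumeOf_pos (c : Fin M → Crossing s) {U : Finset (Fin (vertexCount M s))}
    (hU : U.Nonempty) : 0 < volumeOf (fullCrossSystem c).toGraph U := by
  obtain ⟨v, hv⟩ := hU
  obtain ⟨⟨l, i, d, a⟩, rfl⟩ := vertexIndex.surjective v
  rw [volumeOf_fullCrossSystem, Finset.card_pos]
  refine ⟨(blockEdge l i (a, a), d), Finset.mem_filter.2 ⟨Finset.mem_univ _, ?_⟩⟩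
  rw [mem_unindex, source_blockEdge]
  cases d <;> exact hv

theorem cutSize_pos (hM : 1 ≤ M) (hs : 24 ≤ s) (c : Fin M → Crossing s)
    {U : Finset (Fin (vertexCount M s))} (hU : U.Nonempty) (hU' : Uᶜ.Nonempty) :
    0 < cutSize (fullCrossSystem c).toGraph U := by
  have h := (lt_min (volumeOf_pos c hU) (volumeOf_pos c hU')).trans_le (min_volumeOf_le hM hs c U)
  exact Nat.pos_of_mul_pos_left h

/-- A component that is not everything would be a nontrivial cut without edges. -/
theorem connected_fullCrossSystem (hM : 1 ≤ M) (hs : 24 ≤ s) (c : Fin M → Crossing s) :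
    (fullCrossSystem c).toGraph.Connected := by
  classical
  have hne : Nonempty (Fin (vertexCount M s)) :=
    ⟨vertexIndex (true, ⟨0, hM⟩, true, ⟨0, by omega⟩)⟩
  refine ⟨fun u v => ?_⟩
  by_contra hv
  have hpos := cutSize_pos hM hs c
    (U := Finset.univ.filter fun w => (fullCrossSystem c).toGraph.Reachable u w)
    ⟨u, by simp⟩ ⟨v, by simpa using hv⟩
  rw [cutSize, Set.ncard_pos] at hpos
  obtain ⟨⟨w, w'⟩, h1, h2, h3⟩ := hpos
  simp only [Finset.mem_filter, Finset.mem_univ, true_and] at h1 h2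
  exact h2 (h1.trans h3.reachable)

theorem le_cutConductance (hM : 1 ≤ M) (hs : 24 ≤ s) (c : Fin M → Crossing s)
    {U : Finset (Fin (vertexCount M s))} (hU : U.Nonempty) (hU' : Uᶜ.Nonempty) :
    1 / (5 * (s : ℝ) ^ 2) ≤ cutConductance (fullCrossSystem c).toGraph U := by
  have hpos := lt_min (volumeOf_pos c hU) (volumeOf_pos c hU')
  have hle := min_volumeOf_le hM hs c U
  have hs0 : (0 : ℝ) < s := by exact_mod_cast (by omega : 0 < s)
  rw [cutConductance, div_le_div_iff₀ (by positivity) (by exact_mod_cast hpos), one_mul, mul_comm]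
  exact_mod_cast hle

/-! ### Upper bound on the conductance -/

open Classical in
/-- An outer block, or a block of the hub. -/
noncomputable def blockSet (l : Bool) (i : Fin M) : Finset (Fin (vertexCount M s)) :=
  Finset.univ.filter fun v => (vertexIndex.symm v).1 = l ∧ (vertexIndex.symm v).2.1 = i

theorem mem_unindex_blockSet {l : Bool} {i : Fin M} {v : Vertex M s} :
    v ∈ unindex (blockSet l i) ↔ v.1 = l ∧ v.2.1 = i := by
  simp [mem_unindex, blockSet]

theorem le_card_volumeDarts {W : Finset (Vertex M s)} (l : Bool) (i : Fin M)
    (hW : ∀ d a, (l, i, d, a) ∈ W) : 2 * s ^ 2 ≤ (volumeDarts W).card := by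
  have : 2 * s ^ 2 = (Finset.univ : Finset ((Fin s × Fin s) × Bool)).card := by
    simp [sq, mul_comm]
  rw [this]
  refine Finset.card_le_card_of_injOn (fun z => (blockEdge l i z.1, z.2)) ?_ ?_
  · rintro ⟨e, d⟩ -
    simp only [volumeDarts, Finset.coe_filter, Finset.mem_univ, true_and, Set.mem_ofPred_eq,
      source_blockEdge]
    exact hW _ _
  · rintro ⟨e, d⟩ - ⟨e', d'⟩ - h
    simp only [Prod.mk.injEq, blockEdge_inj] at h
    exact Prod.ext h.1.2.2 h.2

/-- Only the two crossed edges leave an outer block of volume `2 * s ^ 2`; the complement is at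
least as large because it contains the corresponding hub block. -/
theorem cutConductance_blockSet_le (hs : 24 ≤ s) (c : Fin M → Crossing s) (i : Fin M) :
    cutConductance (fullCrossSystem c).toGraph (blockSet false i) ≤ 1 / (s : ℝ) ^ 2 := by
  classical
  have hcut : cutSize (fullCrossSystem c).toGraph (blockSet false i) ≤ 2 := by
    rw [cutSize_fullCrossSystem]
    have hsub : cutDarts c (unindex (blockSet false i)) ⊆
        {(blockEdge false i (c i false), false), (blockEdge false i (c i false), true)} := by
      rintro ⟨x, d⟩ hx
      rw [mem_cutDarts, mem_unindex_blockSet, mem_unindex_blockSet] at hx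
      obtain ⟨p, hp, hxp⟩ := eq_blockEdge_of_leaves hx.1.1 hx.1.2 hx.2
      obtain rfl := Option.some_inj.1 hp
      obtain rfl : x = blockEdge false i (c i false) := hxp
      cases d <;> simp
    exact (Finset.card_le_card hsub).trans Finset.card_le_two
  have hvol : 2 * s ^ 2 ≤ min (volumeOf (fullCrossSystem c).toGraph (blockSet false i))
      (volumeOf (fullCrossSystem c).toGraph (blockSet false i)ᶜ) := by
    rw [volumeOf_fullCrossSystem, volumeOf_fullCrossSystem, unindex_compl]
    refine le_min (le_card_volumeDarts false i ?_) (le_card_volumeDarts true i ?_)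
    · intro d a
      simp [mem_unindex_blockSet]
    · intro d a
      simp [mem_unindex_blockSet]
  have hs0 : (0 : ℝ) < s := by exact_mod_cast (by omega : 0 < s)
  have h1 : ((cutSize (fullCrossSystem c).toGraph (blockSet false i) : ℕ) : ℝ) ≤ 2 := by
    exact_mod_cast hcut
  have h2 : 2 * (s : ℝ) ^ 2 ≤ ((min (volumeOf (fullCrossSystem c).toGraph (blockSet false i))
      (volumeOf (fullCrossSystem c).toGraph (blockSet false i)ᶜ) : ℕ) : ℝ) := by
    exact_mod_cast hvol
  calc cutConductance (fullCrossSystem c).toGraph (blockSet false i)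
      ≤ 2 / (2 * (s : ℝ) ^ 2) := div_le_div₀ (by norm_num) h1 (by positivity) h2
    _ = 1 / (s : ℝ) ^ 2 := by field_simp

theorem conductance_fullCrossSystem_mem (hM : 1 ≤ M) (hs : 24 ≤ s) (c : Fin M → Crossing s) :
    conductance (fullCrossSystem c).toGraph ∈ Set.Icc (1 / (5 * (s : ℝ) ^ 2)) (1 / (s : ℝ) ^ 2) := by
  let U : {U : Finset (Fin (vertexCount M s)) // U.Nonempty ∧ Uᶜ.Nonempty} :=
    ⟨blockSet false ⟨0, hM⟩, ⟨vertexIndex (false, ⟨0, hM⟩, false, ⟨0, by omega⟩), by simp [blockSet]⟩,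
      ⟨vertexIndex (true, ⟨0, hM⟩, false, ⟨0, by omega⟩), by simp [blockSet]⟩⟩
  have : Nonempty {U : Finset (Fin (vertexCount M s)) // U.Nonempty ∧ Uᶜ.Nonempty} := ⟨U⟩
  constructor
  · exact le_ciInf fun V => le_cutConductance hM hs c V.2.1 V.2.2
  · exact (ciInf_le (Set.finite_range _).bddBelow U).trans (cutConductance_blockSet_le hs c _)

end Conductance

/-! ### Choice of the parameters -/

theorem mainTheorem5 :
    ∃ a₁ a₂ b₁ b₂ c : ℝ, 0 < a₁ ∧ 0 < a₂ ∧ 0 < b₁ ∧ 0 < b₂ ∧ 0 < c ∧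
      ∀ A : DistAlgorithm, A.ConstructsSpanningTrees →
        ∃ n₀ : ℕ, ∀ n : ℕ, n₀ ≤ n →
          ∀ α : ℝ, 1 / (n : ℝ) ^ 2 < α → α < 1 / 12 ^ 2 →
            ∃ (k : ℕ) (N : Network k),
              N.graph.Connected ∧
              a₁ * n ≤ k ∧ (k : ℝ) ≤ a₂ * n ∧
              b₁ * α ≤ conductance N.graph ∧ conductance N.graph ≤ b₂ * α ∧
              ENNReal.ofReal (c * (n / √(conductance N.graph))) ≤ A.expectedMessages N := by
  -- The network has `4 * M * s` nodes with `n ≤ M * s ≤ n + s ≤ 4 * n`. From `2 ≤ s√α ≤ 3` and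
  -- `1/(5s²) ≤ φ ≤ 1/s²` come `1/45 = 1/(5·3²)` and `1/4 = 1/2²`; `1/96` is `1/32` from the message
  -- bound times `1/3` from `1/√φ ≤ √5 s ≤ 3s`.
  refine ⟨4, 16, 1 / 45, 1 / 4, 1 / 96, by norm_num, by norm_num, by norm_num, by norm_num,
    by norm_num, fun A hA => ?_⟩
  obtain ⟨err, herr, hA⟩ := hA
  obtain ⟨n₀, hn₀⟩ := eventually_atTop.1 (herr.eventually (gt_mem_nhds (by norm_num :
    (0 : ℝ) < 1 / 4)))
  refine ⟨max n₀ 1, fun n hn α hα1 hα2 => ?_⟩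
  have hn1 : (1 : ℝ) ≤ n := by exact_mod_cast (le_max_right n₀ 1).trans hn
  have hα0 : 0 < α := lt_of_le_of_lt (by positivity) hα1
  -- the size of the blocks
  set β := √α with hβ
  have hβ0 : 0 < β := Real.sqrt_pos.2 hα0
  have hβα : β ^ 2 = α := Real.sq_sqrt hα0.le
  have hβ1 : β < 1 / 12 := by
    rw [← hβα] at hα2
    exact lt_of_pow_lt_pow_left₀ 2 (by norm_num) (by rwa [div_pow, one_pow])
  have hβn : 1 < n * β := by
    have h1 : (1 : ℝ) ^ 2 < (n * β) ^ 2 := by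
      rw [one_pow, mul_pow, hβα]
      rwa [div_lt_iff₀' (by positivity)] at hα1
    exact lt_of_pow_lt_pow_left₀ 2 (by positivity) h1
  -- The factor `2` turns `α < 1/12²` into `s ≥ 24`, and `α > 1/n²` keeps the block size at most
  -- `3n`.
  set s := ⌈2 / β⌉₊ with hs_def
  have hs1 : 2 ≤ s * β := by
    have := Nat.le_ceil (2 / β)
    rwa [div_le_iff₀ hβ0] at this
  have hs2 : s * β ≤ 2 + β := by
    have := (Nat.ceil_lt_add_one (by positivity : 0 ≤ 2 / β)).le
    calc (s : ℝ) * β ≤ (2 / β + 1) * β := by gcongr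
      _ = 2 + β := by field_simp
  have hs : 24 ≤ s := by
    have : (24 : ℝ) ≤ s := by nlinarith
    exact_mod_cast this
  have hs0 : (0 : ℝ) < s := by exact_mod_cast (by omega : 0 < s)
  have hsn : (s : ℝ) ≤ 3 * n := by
    have : (s : ℝ) * β ≤ 3 * n * β := by nlinarith
    exact le_of_mul_le_mul_right this hβ0
  -- the number of the blocks
  set M := ⌈(n : ℝ) / s⌉₊ with hM_def
  have hM1 : (n : ℝ) ≤ M * s := by
    have := Nat.le_ceil ((n : ℝ) / s)
    rwa [div_le_iff₀ hs0] at this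
  have hM2 : (M : ℝ) * s ≤ n + s := by
    have := (Nat.ceil_lt_add_one (by positivity : 0 ≤ (n : ℝ) / s)).le
    calc (M : ℝ) * s ≤ (n / s + 1) * s := by gcongr
      _ = n + s := by field_simp
  have hM : 1 ≤ M := Nat.ceil_pos.2 (by positivity)
  have hk : ((vertexCount M s : ℕ) : ℝ) = 4 * (M * s) := by
    rw [vertexCount_eq]; push_cast; ring
  have hkn : n₀ ≤ vertexCount M s := by
    have h1 : (n : ℝ) ≤ (vertexCount M s : ℕ) := by rw [hk]; linarith
    exact ((le_max_left n₀ 1).trans hn).trans (by exact_mod_cast h1)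
  have hsuccess : ∀ c : Fin M → Crossing s,
      3 / 4 ≤ nodeCoins _ {r | A.Success (fullCrossSystem c).toNetwork r} := by
    intro c
    have h1 := hA _ (fullCrossSystem c).toNetwork (connected_fullCrossSystem hM hs c)
    have h2 := hn₀ _ hkn
    have h3 : (3 / 4 : ℝ) ≤ (nodeCoins _).real {r | A.Success (fullCrossSystem c).toNetwork r} := by
      linarith
    have h4 : (3 / 4 : ℝ≥0∞) = ENNReal.ofReal (3 / 4) := by
      rw [ENNReal.ofReal_div_of_pos (by norm_num)]; norm_num
    rw [h4]
    exact (ENNReal.ofReal_le_iff_le_toReal (measure_ne_top _ _)).2 h3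
  obtain ⟨c, hc⟩ := exists_le_expectedMessages A hs hsuccess
  obtain ⟨hφ1, hφ2⟩ := conductance_fullCrossSystem_mem hM hs c
  refine ⟨vertexCount M s, (fullCrossSystem c).toNetwork, connected_fullCrossSystem hM hs c,
    by rw [hk]; linarith, by rw [hk]; linarith, ?_, ?_, ?_⟩
  · refine le_trans ?_ hφ1
    rw [le_div_iff₀ (by positivity), ← hβα]
    have : (s * β) ^ 2 ≤ 3 ^ 2 := pow_le_pow_left₀ (by positivity) (by linarith) 2
    nlinarith
  · refine hφ2.trans ?_
    rw [div_le_iff₀ (by positivity), ← hβα]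
    have : 2 ^ 2 ≤ (s * β) ^ 2 := pow_le_pow_left₀ (by norm_num) hs1 2
    nlinarith
  · change ENNReal.ofReal (1 / 96 * (n / √(conductance (fullCrossSystem c).toGraph))) ≤ _
    set φ := conductance (fullCrossSystem c).toGraph
    have hφ0 : 0 < φ := lt_of_lt_of_le (by positivity) hφ1
    have hsq : 1 / √φ ≤ 3 * s := by
      rw [div_le_iff₀ (Real.sqrt_pos.2 hφ0)]
      have h1 : 1 / (3 * (s : ℝ)) ≤ √φ := by
        apply Real.le_sqrt_of_sq_le
        refine le_trans ?_ hφ1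
        rw [div_pow, one_pow]
        exact one_div_le_one_div_of_le (by positivity) (by nlinarith)
      rw [div_le_iff₀ (by positivity)] at h1
      linarith
    have hreal : 1 / 96 * (n / √φ) ≤ (M * s ^ 2 : ℕ) / 32 := by
      have h1 : (n : ℝ) / √φ ≤ (M * s) * (3 * s) := by
        rw [div_eq_mul_one_div]
        exact mul_le_mul hM1 hsq (by positivity) (by positivity)
      push_cast
      nlinarith
    refine (ENNReal.ofReal_le_ofReal hreal).trans ?_
    rw [ENNReal.ofReal_div_of_pos (by norm_num), ENNReal.ofReal_natCast]
    refine ENNReal.div_le_of_le_mul ?_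
    rw [mul_comm (A.expectedMessages _)]
    simpa using hc
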